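/- Let $K$ be an algebraically closed field, complete or not, with a nontrivial non-Archimedean absolute value $|\cdot|$ (for instance the Puiseux series over an algebraically closed field of characteristic $0$, or their completion, the Levi-Civita field). Let $\mathbb P^1_{\mathrm{an}}=\mathbb P^1_{\mathrm{an}}(K)$ be the Berkovich projective line, whose points $\zeta$ are regarded as multiplicative seminorms $\|\cdot\|_\zeta$ on $K(y)$, with values in $[0,\infty]$ ($\infty$ at poles; multiplicativity is required except for products $0\cdot\infty$), that extend $|\cdot|$, with the topology of pointwise convergence. A dilating skew endomorphism of scale factor $q>0$ is an endomorphism $\Psi$ of the field $K(y)$ that restricts to an automorphism of $K$ with $|\Psi(a)|=|a|^{1/q}$ for all $a\in K$; the skew product $\Psi_*:\mathbb P^1_{\mathrm{an}}\to\mathbb P^1_{\mathrm{an}}$ that it defines is given by $\|f\|_{\Psi_*(\zeta)}=\|\Psi(f)\|_\zeta^{\,q}$. Let $N\ge 1$. A periodic chain of $N$ skew products consists of copies $\mathbb P^1_{\mathrm{an},(j)}$ of $\mathbb P^1_{\mathrm{an}}$ and skew products $\phi_*^{(j)}:\mathbb P^1_{\mathrm{an},(j)}\to\mathbb P^1_{\mathrm{an},(j+1)}$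 (the scale factors may depend on $j$), with indices $j$ taken modulo $N$. Write $\phi_*^n=\phi_*^{(j+n-1)}\circ\cdots\circ\phi_*^{(j)}:\mathbb P^1_{\mathrm{an},(j)}\to\mathbb P^1_{\mathrm{an},(j+n)}$. For each $j$ let $\Gamma_{(j)}\subset\mathbb P^1_{\mathrm{an},(j)}$ be a vertex set, that is, a finite set of Type II points (points $\zeta(a,r)$, the supremum norm on the disk $\{b\in K:|b-a|\le r\}$, with $a\in K$ and $r\in|K^\times|$). A $\Gamma_{(j)}$-domain is a connected component $U$ of $\mathbb P^1_{\mathrm{an},(j)}\setminus\Gamma_{(j)}$. It is an F-domain if $\phi_*^n(U)\cap\Gamma_{(j+n)}=\emptyset$ for all $n\ge1$, and a J-domain otherwise. A point $\zeta\in\Gamma_{(j)}$ is destabilising if there is an $n\in\mathbb N$ such that $\phi_*^n(\zeta)$ lies in a J-domain of $\Gamma_{(j+n)}$. The chain together with its vertex sets is analytically stable if no $\Gamma_{(j)}$ contains a destabilising point. Then $(\phi_*^{(j)},\Gamma_{(j)})_{j=1}^N$ is analytically stable if and only if for every $j$ and every $\zeta\in\Gamma_{(j)}$, either $\phi_*^{(j)}(\zeta)\in\Gamma_{(j+1)}$,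 or $\phi_*^{(j)}(\zeta)\in U$ for some F-domain $U$ of $\Gamma_{(j+1)}$. -/

import Mathlib

open scoped ENNReal

/-- The Berkovich projective line over a field `K` with a non-Archimedean absolute value, as the
space of multiplicative seminorms on the field `K(y)` that extend the absolute value of `K` and may
take the value `∞` (at poles).

A point either is finite everywhere, and then it is a multiplicative norm on `K(y)`; or
`{f | ζ f < ∞}` is a proper valuation ring of `K(y)` over `K` with maximal ideal `{f | ζ f = 0}`,
and then (for `K` algebraically closed) `ζ f = |f(a)|` for a classical point `a ∈ ℙ¹(K)`.
Restriction to `K[y]` thus identifies the points with `ζ y < ∞` with the multiplicative seminorms on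
`K[y]` that extend the absolute value of `K`, that is, with the Berkovich affine line; the only other
point is `∞`. The product rule is void exactly for the indeterminate products `0 · ∞`. -/
@[ext]
structure BerkovichP1 (K : Type*) [NontriviallyNormedField K] where
  /-- The seminorm, as a function on `K(y)`. -/
  toFun : RatFunc K → ℝ≥0∞
  map_C' : ∀ a : K, toFun (RatFunc.C a) = ‖a‖ₑ
  map_add_le' : ∀ f g : RatFunc K, toFun (f + g) ≤ max (toFun f) (toFun g)
  map_mul' : ∀ f g : RatFunc K, ¬ (toFun f = 0 ∧ toFun g = ∞) → ¬ (toFun f = ∞ ∧ toFun g = 0) →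
    toFun (f * g) = toFun f * toFun g

namespace BerkovichP1

instance {K : Type*} [NontriviallyNormedField K] :
    CoeFun (BerkovichP1 K) (fun _ => RatFunc K → ℝ≥0∞) :=
  ⟨BerkovichP1.toFun⟩

/-- The Berkovich topology: the coarsest one for which all the evaluations `ζ ↦ ζ f ∈ [0, ∞]`
are continuous. -/
instance {K : Type*} [NontriviallyNormedField K] : TopologicalSpace (BerkovichP1 K) :=
  TopologicalSpace.induced BerkovichP1.toFun inferInstance

/-- `ζ` is a Type II point: `ζ = ζ(a, r)` is the supremum norm on a closed disk
`{b ∈ K : |b - a| ≤ r}` with centre `a ∈ K` and radius `r = |c|`, where `c ∈ K`, `c ≠ 0`. -/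
def IsTypeII {K : Type*} [NontriviallyNormedField K] (ζ : BerkovichP1 K) : Prop :=
  ∃ a c : K, c ≠ 0 ∧ ∀ f : Polynomial K,
    ζ (algebraMap (Polynomial K) (RatFunc K) f) =
      ⨆ b ∈ Metric.closedBall a ‖c‖, ‖f.eval b‖ₑ

/-- A vertex set: a finite set of Type II points. -/
def IsVertexSet {K : Type*} [NontriviallyNormedField K] (Γ : Set (BerkovichP1 K)) : Prop :=
  Γ.Finite ∧ ∀ ζ ∈ Γ, IsTypeII ζ

/-- `U` is a `Γ`-domain: a connected component of the complement of `Γ`. -/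
def IsGammaDomain {K : Type*} [NontriviallyNormedField K] (Γ U : Set (BerkovichP1 K)) : Prop :=
  ∃ ζ ∈ Γᶜ, U = connectedComponentIn Γᶜ ζ

end BerkovichP1

/-- A dilating skew endomorphism of `K(y)` with scale factor `q`: an endomorphism `Ψ` of the field
`K(y)` that restricts to an automorphism `Ψ₁` of `K` with `|Ψ₁ a| = |a| ^ (1 / q)`. -/
structure DilatingSkewEndomorphism (K : Type*) [NontriviallyNormedField K] where
  /-- The endomorphism `Ψ` of `K(y)`. -/
  toRingHom : RatFunc K →+* RatFunc K
  /-- The automorphism `Ψ₁` of `K`. -/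
  base : K ≃+* K
  map_C : ∀ a : K, toRingHom (RatFunc.C a) = RatFunc.C (base a)
  /-- The scale factor `q`. -/
  scale : ℝ
  scale_pos : 0 < scale
  norm_base : ∀ a : K, ‖base a‖ = ‖a‖ ^ (1 / scale)

namespace DilatingSkewEndomorphism

/-- The skew product `Ψ_*` on the Berkovich projective line: `(Ψ_* ζ)(f) = ζ(Ψ f) ^ q`. -/
noncomputable def skewProduct {K : Type*} [NontriviallyNormedField K]
    (Ψ : DilatingSkewEndomorphism K) (ζ : BerkovichP1 K) : BerkovichP1 K where
  toFun f := ζ (Ψ.toRingHom f) ^ Ψ.scale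
  map_C' a := by
    have h := Ψ.scale_pos
    rw [Ψ.map_C, ζ.map_C', ← ofReal_norm, ← ofReal_norm, Ψ.norm_base,
      ENNReal.ofReal_rpow_of_nonneg (by positivity) h.le, ← Real.rpow_mul (norm_nonneg _),
      one_div_mul_cancel h.ne', Real.rpow_one]
  map_add_le' f g := by
    have h := ENNReal.monotone_rpow_of_nonneg Ψ.scale_pos.le
    rw [map_add, ← h.map_max]
    exact h (ζ.map_add_le' _ _)
  map_mul' f g h₁ h₂ := by
    have h := Ψ.scale_pos
    have hz : ∀ x : ℝ≥0∞, x ^ Ψ.scale = 0 ↔ x = 0 := fun x => ENNReal.rpow_eq_zero_iff_of_pos h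
    have ht : ∀ x : ℝ≥0∞, x ^ Ψ.scale = ∞ ↔ x = ∞ := fun x => ENNReal.rpow_eq_top_iff_of_pos h
    rw [hz, ht] at h₁ h₂
    rw [map_mul, ζ.map_mul' _ _ h₁ h₂, ENNReal.mul_rpow_of_nonneg _ _ h.le]

end DilatingSkewEndomorphism

/-- A periodic chain of `N` skew products over `K`, with indices modulo `N`: the `j`-th map
`φ_*⁽ʲ⁾` goes from the `j`-th to the `(j+1)`-st copy of the Berkovich projective line. -/
abbrev PeriodicChain (K : Type*) [NontriviallyNormedField K] (N : ℕ) : Type _ :=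
  ZMod N → DilatingSkewEndomorphism K

namespace PeriodicChain

open BerkovichP1

/-- The composition `φ_*ⁿ = φ_*⁽ʲ⁺ⁿ⁻¹⁾ ∘ ⋯ ∘ φ_*⁽ʲ⁾`, from the `j`-th to the `(j+n)`-th copy. -/
noncomputable def iter {K : Type*} [NontriviallyNormedField K] {N : ℕ} (φ : PeriodicChain K N)
    (j : ZMod N) : ℕ → BerkovichP1 K → BerkovichP1 K
  | 0 => id
  | n + 1 => (φ (j + n)).skewProduct ∘ iter φ j n

/-- `U` is an F-domain of `Γ j`: a `Γ j`-domain none of whose forward images meets the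
vertex set of its copy. -/
def IsFDomain {K : Type*} [NontriviallyNormedField K] {N : ℕ} (φ : PeriodicChain K N)
    (Γ : ZMod N → Set (BerkovichP1 K)) (j : ZMod N) (U : Set (BerkovichP1 K)) : Prop :=
  IsGammaDomain (Γ j) U ∧ ∀ n : ℕ, 1 ≤ n → (φ.iter j n '' U) ∩ Γ (j + n) = ∅

/-- `U` is a J-domain of `Γ j`: a `Γ j`-domain that is not an F-domain. -/
def IsJDomain {K : Type*} [NontriviallyNormedField K] {N : ℕ} (φ : PeriodicChain K N)
    (Γ : ZMod N → Set (BerkovichP1 K)) (j : ZMod N) (U : Set (BerkovichP1 K)) : Prop :=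
  IsGammaDomain (Γ j) U ∧ ¬ IsFDomain φ Γ j U

/-- `ζ ∈ Γ j` is destabilising: some forward image of `ζ` lies in a J-domain. -/
def IsDestabilising {K : Type*} [NontriviallyNormedField K] {N : ℕ} (φ : PeriodicChain K N)
    (Γ : ZMod N → Set (BerkovichP1 K)) (j : ZMod N) (ζ : BerkovichP1 K) : Prop :=
  ζ ∈ Γ j ∧ ∃ n : ℕ, ∃ U : Set (BerkovichP1 K), IsJDomain φ Γ (j + n) U ∧ φ.iter j n ζ ∈ U

/-- The chain with its vertex sets is analytically stable: no `Γ j` has a destabilising point. -/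
def IsAnalyticallyStable {K : Type*} [NontriviallyNormedField K] {N : ℕ} (φ : PeriodicChain K N)
    (Γ : ZMod N → Set (BerkovichP1 K)) : Prop :=
  ∀ j : ZMod N, ∀ ζ ∈ Γ j, ¬ IsDestabilising φ Γ j ζ

end PeriodicChain

/-! Stability implies the one-step criterion by taking n = 1 in the definition. For the converse, it
suffices that one step sends every point of an F-domain to a vertex or into an F-domain; induction
on n then keeps all orbits of vertices out of J-domains.

Let f be one step and U an F-domain. Since f(U) avoids the next vertex set, it lies in one domain W.
If f(U) = W, the forward images of W are forward images of U, so W is an F-domain. Otherwise some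
vertex is mapped into W, because f is open and the space is compact
(`image_connectedComponentIn_eq_or_exists_mem`). By the criterion that vertex lands in an F-domain,
which must be W (`IsFDomain.isVertexOrF_skewProduct`).

The topological input is that the Berkovich line is compact, Hausdorff and locally connected, and
that skew products are continuous and open. Openness (`isOpenMap_skewProduct`) is the hard part. If
it fails at ζ, some classical points b tending to f(ζ) have all their preimages outside a fixed
neighbourhood of ζ. By compactness these preimages tend to points ξᵢ ≠ ζ. Weak approximation gives a
function w with ζ(w) < 1 < ξᵢ(w) for all i. The resultant that eliminates y between Ψ(y) and w is a
polynomial relation for w over the target field. Its roots over b are the values of w on the fibre,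
so near the limit its constant coefficient dominates. In the limit the relation itself forces ζ(w) ≥
1, a contradiction. -/

namespace BerkovichP1

/-! ### Arithmetic of seminorms with values in [0, ∞]. -/

section Basic

variable {K : Type*} [NontriviallyNormedField K] (ζ : BerkovichP1 K)

theorem map_zero : ζ 0 = 0 := by simpa using ζ.map_C' 0

theorem map_one : ζ 1 = 1 := by simpa using ζ.map_C' 1

theorem map_C_mul {c : K} (hc : c ≠ 0) (f : RatFunc K) : ζ (RatFunc.C c * f) = ‖c‖ₑ * ζ f := by
  rw [ζ.map_mul', ζ.map_C'] <;> simp [ζ.map_C', hc]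

theorem map_neg (f : RatFunc K) : ζ (-f) = ζ f := by
  have := ζ.map_C_mul (c := -1) (by simp) f
  simpa using this

theorem map_sub_le (f g : RatFunc K) : ζ (f - g) ≤ max (ζ f) (ζ g) := by
  rw [sub_eq_add_neg, ← ζ.map_neg g]
  exact ζ.map_add_le' _ _

/-- The cases 0 and ∞ are included: any other value of the inverse would make the product
determinate, and the product rule would contradict f · f⁻¹ = 1. -/
theorem map_inv {f : RatFunc K} (hf : f ≠ 0) : ζ f⁻¹ = (ζ f)⁻¹ := by
  by_cases h0 : ζ f = 0
  · rw [h0, ENNReal.inv_zero]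
    by_contra h
    have := ζ.map_mul' f f⁻¹ (fun h' => h h'.2) (by simp [h0])
    rw [mul_inv_cancel₀ hf, h0, zero_mul, map_one] at this
    exact one_ne_zero this
  by_cases ht : ζ f = ∞
  · rw [ht, ENNReal.inv_top]
    by_contra h
    have := ζ.map_mul' f f⁻¹ (fun h' => h0 h'.1) (fun h' => h h'.2)
    rw [mul_inv_cancel₀ hf, ht, ENNReal.top_mul h, map_one] at this
    exact ENNReal.one_ne_top this
  have := ζ.map_mul' f⁻¹ f (by tauto) (by tauto)
  rw [inv_mul_cancel₀ hf, map_one] at this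
  exact ENNReal.eq_inv_of_mul_eq_one_left this.symm

theorem map_pow (f : RatFunc K) (n : ℕ) : ζ (f ^ n) = ζ f ^ n := by
  induction n with
  | zero => simp [map_one]
  | succ n ih =>
    rw [pow_succ, pow_succ, ζ.map_mul', ih]
    · rw [ih]
      rintro ⟨h1, h2⟩
      rw [h2] at h1
      rcases n with _ | n
      · simp at h1
      · simp at h1
    · rw [ih]
      rintro ⟨h1, h2⟩
      rw [h2] at h1
      rcases n with _ | n
      · simp at h1
      · simp at h1

theorem map_sum_le {ι : Type*} (s : Finset ι) (f : ι → RatFunc K) {B : ℝ≥0∞}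
    (h : ∀ i ∈ s, ζ (f i) ≤ B) : ζ (∑ i ∈ s, f i) ≤ B := by
  classical
  induction s using Finset.induction_on with
  | empty => simp [map_zero]
  | insert a s ha ih =>
    rw [Finset.sum_insert ha]
    exact (ζ.map_add_le' _ _).trans
      (max_le (h a (by simp)) (ih fun i hi => h i (by simp [hi])))

theorem map_add_eq_right {f g : RatFunc K} (h : ζ f < ζ g) : ζ (f + g) = ζ g := by
  apply le_antisymm ((ζ.map_add_le' f g).trans (max_le h.le le_rfl))
  have := ζ.map_sub_le (f + g) f
  rw [add_sub_cancel_left] at this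
  exact (le_max_iff.1 this).resolve_right (not_le.2 h)

theorem map_X_sub_C_le (a b : K) :
    ζ (RatFunc.X - RatFunc.C b) ≤ max (ζ (RatFunc.X - RatFunc.C a)) ‖a - b‖ₑ := by
  have := ζ.map_add_le' (RatFunc.X - RatFunc.C a) (RatFunc.C (a - b))
  rw [ζ.map_C'] at this
  simpa using this

theorem enorm_sub_le_max (a b : K) :
    ‖a - b‖ₑ ≤ max (ζ (RatFunc.X - RatFunc.C a)) (ζ (RatFunc.X - RatFunc.C b)) := by
  have := ζ.map_sub_le (RatFunc.X - RatFunc.C b) (RatFunc.X - RatFunc.C a)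
  rw [sub_sub_sub_cancel_left, ← _root_.map_sub, ζ.map_C', max_comm] at this
  exact this

/-- The right side does not depend on ζ: raised to a radius at least its distance from a, every
point becomes the disk point ζ(a, ρ). This is why paths towards ∞ merge. -/
theorem max_X_sub_C_eq {a b : K} {ρ : ℝ≥0∞} (h : ζ (RatFunc.X - RatFunc.C a) ≤ ρ) :
    max (ζ (RatFunc.X - RatFunc.C b)) ρ = max ‖a - b‖ₑ ρ := by
  apply le_antisymm
  · apply max_le _ (le_max_right _ _)
    exact (ζ.map_X_sub_C_le a b).trans (max_le (h.trans (le_max_right _ _)) (le_max_left _ _))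
  · apply max_le _ (le_max_right _ _)
    exact (ζ.enorm_sub_le_max a b).trans (max_le (h.trans (le_max_right _ _)) (le_max_left _ _))

end Basic

/-! ### Classical points. -/

section Classical

variable {K : Type*} [NontriviallyNormedField K] [IsUltrametricDist K]

open Classical in
/-- The classical (Type I) point of the Berkovich projective line attached to `a ∈ K`. -/
noncomputable def classical (a : K) : BerkovichP1 K where
  toFun f := if f.denom.eval a = 0 then ∞ else ‖f.num.eval a / f.denom.eval a‖ₑ
  map_C' c := by simp
  map_add_le' f g := by
    by_cases hf : f.denom.eval a = 0
    · simp [hf]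
    by_cases hg : g.denom.eval a = 0
    · simp [hg]
    have hfg : (f + g).denom.eval a ≠ 0 := fun h =>
      mul_ne_zero hf hg (by
        rw [← Polynomial.eval_mul]
        exact Polynomial.eval_eq_zero_of_dvd_of_eval_eq_zero (RatFunc.denom_add_dvd f g) h)
    have := RatFunc.eval_add (f := RingHom.id K) (a := a) (x := f) (y := g) hf hg
    simp only [RatFunc.eval, Polynomial.eval₂_id] at this
    rw [if_neg hf, if_neg hg, if_neg hfg, this]
    simp only [← ofReal_norm, ← ENNReal.ofReal_max]
    exact ENNReal.ofReal_le_ofReal (IsUltrametricDist.norm_add_le_max _ _)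
  map_mul' f g h₁ h₂ := by
    -- A pole of f survives in f · g unless g vanishes there: by coprimality both numerators are
    -- nonzero at a, so the reduced denominator of the product must vanish.
    have key : ∀ f g : RatFunc K, f.denom.eval a = 0 →
        (if g.denom.eval a = 0 then ∞ else ‖g.num.eval a / g.denom.eval a‖ₑ) ≠ 0 →
        (f * g).denom.eval a = 0 := by
      intro f g hf hg
      have h := congrArg (Polynomial.eval a) (RatFunc.num_denom_mul f g)
      simp only [Polynomial.eval_mul, hf, zero_mul, mul_zero] at h
      have hnf : f.num.eval a ≠ 0 := by
        intro h0
        obtain ⟨u, v, huv⟩ := RatFunc.isCoprime_num_denom f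
        have := congrArg (Polynomial.eval a) huv
        simp [h0, hf] at this
      have hng : g.num.eval a ≠ 0 := by
        intro h0
        by_cases hd : g.denom.eval a = 0
        · obtain ⟨u, v, huv⟩ := RatFunc.isCoprime_num_denom g
          have := congrArg (Polynomial.eval a) huv
          simp [h0, hd] at this
        · simp [h0, hd] at hg
      exact (mul_eq_zero.1 h.symm).resolve_left (mul_ne_zero hnf hng)
    by_cases hf : f.denom.eval a = 0
    · rw [if_pos hf] at h₂ ⊢
      have hg := fun h => h₂ ⟨rfl, h⟩
      rw [if_pos (key f g hf hg), ENNReal.top_mul hg]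
    by_cases hg : g.denom.eval a = 0
    · rw [if_pos hg] at h₁ ⊢
      have hf := fun h => h₁ ⟨h, rfl⟩
      rw [if_pos (by rw [mul_comm]; exact key g f hg hf), ENNReal.mul_top hf]
    have hfg : (f * g).denom.eval a ≠ 0 := fun h =>
      mul_ne_zero hf hg (by
        rw [← Polynomial.eval_mul]
        exact Polynomial.eval_eq_zero_of_dvd_of_eval_eq_zero (RatFunc.denom_mul_dvd f g) h)
    have := RatFunc.eval_mul (f := RingHom.id K) (a := a) (x := f) (y := g) hf hg
    simp only [RatFunc.eval, Polynomial.eval₂_id] at this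
    rw [if_neg hf, if_neg hg, if_neg hfg, this, enorm_mul]

open Classical in
theorem classical_apply (a : K) (f : RatFunc K) :
    classical a f = if f.denom.eval a = 0 then ∞ else ‖f.num.eval a / f.denom.eval a‖ₑ := rfl

theorem classical_algebraMap (a : K) (p : Polynomial K) :
    classical a (algebraMap (Polynomial K) (RatFunc K) p) = ‖p.eval a‖ₑ := by
  simp [classical_apply]

theorem classical_div (a : K) (p : Polynomial K) {q : Polynomial K} (hq : q.eval a ≠ 0) :
    classical a (algebraMap (Polynomial K) (RatFunc K) p / algebraMap (Polynomial K) (RatFunc K) q)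
      = ‖p.eval a / q.eval a‖ₑ := by
  have hq0 : q ≠ 0 := by rintro rfl; simp at hq
  have hqa := RatFunc.algebraMap_ne_zero hq0
  rw [div_eq_mul_inv, (classical a).map_mul', (classical a).map_inv hqa, classical_algebraMap,
    classical_algebraMap, div_eq_mul_inv, enorm_mul, enorm_inv hq] <;>
  rw [(classical a).map_inv hqa, classical_algebraMap, classical_algebraMap] <;> simp [hq]

theorem classical_X_sub_C (a b : K) :
    classical a (RatFunc.X - RatFunc.C b) = ‖a - b‖ₑ := by
  have := classical_algebraMap a (Polynomial.X - Polynomial.C b)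
  simpa [RatFunc.algebraMap_X, RatFunc.algebraMap_C] using this

end Classical

end BerkovichP1

/-! ### Density of the value group and generic points of disks. -/

section Field

theorem norm_sub_le_max' {K : Type*} [NormedRing K] [IsUltrametricDist K] (a b : K) :
    ‖a - b‖ ≤ max ‖a‖ ‖b‖ := by
  rw [sub_eq_add_neg, ← norm_neg b]
  exact IsUltrametricDist.norm_add_le_max _ _

variable {K : Type*} [NontriviallyNormedField K] [IsAlgClosed K]

/-- The n-th roots of powers of one π with |π| > 1 have norms |π|^(m/n). Taking |π| < (v/w)^n, with
w strictly between u and v, makes the spacing finer than the interval (w, v). -/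
theorem exists_norm_between {u v : ℝ} (hu : 0 ≤ u) (huv : u < v) :
    ∃ c : K, u < ‖c‖ ∧ ‖c‖ < v := by
  obtain ⟨w, huw, hwv⟩ := exists_between huv
  have hw : 0 < w := hu.trans_lt huw
  obtain ⟨π, hπ⟩ := NormedField.exists_one_lt_norm K
  obtain ⟨n, hn⟩ := pow_unbounded_of_one_lt ‖π‖ ((one_lt_div hw).2 hwv)
  have hn0 : n ≠ 0 := by rintro rfl; simp at hn; linarith
  obtain ⟨m, hm1, hm2⟩ := exists_mem_Ioc_zpow (pow_pos (hw.trans hwv) n) hπ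
  obtain ⟨c, hc⟩ := IsAlgClosed.exists_pow_nat_eq (π ^ m) (Nat.pos_of_ne_zero hn0)
  have hcn : ‖c‖ ^ n = ‖π‖ ^ m := by rw [← norm_pow, hc, norm_zpow]
  refine ⟨c, huw.trans ?_, ?_⟩
  · refine lt_of_pow_lt_pow_left₀ n (norm_nonneg _) ?_
    rw [hcn]
    rw [div_pow, lt_div_iff₀ (pow_pos hw n)] at hn
    have hπ0 : 0 < ‖π‖ := one_pos.trans hπ
    rw [zpow_add_one₀ hπ0.ne', mul_comm] at hm2
    exact lt_of_mul_lt_mul_left (hn.trans_le hm2) hπ0.le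
  · refine lt_of_pow_lt_pow_left₀ n (hw.trans hwv).le ?_
    rwa [hcn]

theorem exists_enorm_between {u v : ℝ≥0∞} (huv : u < v) :
    ∃ c : K, u < ‖c‖ₑ ∧ ‖c‖ₑ < v := by
  obtain ⟨w, huw, hwv⟩ := exists_between huv
  have hut := (huw.trans hwv).ne_top
  have hwt := hwv.ne_top
  obtain ⟨c, h1, h2⟩ := exists_norm_between (K := K) ENNReal.toReal_nonneg
    ((ENNReal.toReal_lt_toReal (huw.ne_top) hwt).2 huw)
  rw [← toReal_enorm] at h1 h2
  exact ⟨c, (ENNReal.toReal_lt_toReal huw.ne_top enorm_ne_top).1 h1,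
    ((ENNReal.toReal_lt_toReal enorm_ne_top hwt).1 h2).trans hwv⟩

variable (K) in
theorem denseRange_enorm : DenseRange (fun c : K => ‖c‖ₑ) :=
  dense_of_exists_between fun _ _ h => by
    obtain ⟨c, h1, h2⟩ := exists_enorm_between (K := K) h
    exact ⟨_, ⟨c, rfl⟩, h1, h2⟩

variable [IsUltrametricDist K]

theorem exists_norm_le_one_forall_one_le_norm_sub (S : Finset K) :
    ∃ t : K, ‖t‖ ≤ 1 ∧ ∀ b ∈ S, 1 ≤ ‖t - b‖ := by
  classical
  let S' := S.filter (‖·‖ ≤ 1)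
  let q : Polynomial K := ∏ b ∈ S', (Polynomial.X - Polynomial.C b)
  have hq : q.Monic := Polynomial.monic_prod_of_monic _ _ fun b _ => Polynomial.monic_X_sub_C b
  have hXq : (Polynomial.X * q).natDegree = q.natDegree + 1 := by
    rw [Polynomial.natDegree_X_mul hq.ne_zero]
  -- A root satisfies t · ∏ (t - b) = 1. Once |t| ≤ 1, all factors have norm at most 1, so each has
  -- norm exactly 1. The factor X keeps the degree positive when there are no b.
  obtain ⟨t, ht⟩ := IsAlgClosed.exists_root (Polynomial.X * q - Polynomial.C 1) (by
    apply ne_of_gt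
    apply Polynomial.natDegree_pos_iff_degree_pos.1
    rw [Polynomial.natDegree_sub_C, hXq]
    exact Nat.succ_pos _)
  have ht' : t * ∏ b ∈ S', (t - b) = 1 := by
    simpa [q, Polynomial.eval_prod, sub_eq_zero] using ht
  have htn : ‖t‖ * ∏ b ∈ S', ‖t - b‖ = 1 := by
    rw [← norm_prod, ← norm_mul, ht', norm_one]
  have hsub : ∀ b ∈ S', ‖t - b‖ ≤ max ‖t‖ ‖b‖ := fun b _ =>
    norm_sub_le_max' t b
  have ht1 : ‖t‖ ≤ 1 := by
    by_contra! h
    have : 1 ≤ ∏ b ∈ S', ‖t - b‖ := by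
      refine Finset.prod_induction _ (1 ≤ ·) (fun a b ha hb => one_le_mul_of_one_le_of_one_le ha hb)
        le_rfl fun b hb => ?_
      have hb1 := (Finset.mem_filter.1 hb).2
      by_contra! h3
      have h4 := norm_sub_le_max' (t - b) (-b)
      rw [sub_neg_eq_add, sub_add_cancel, norm_neg] at h4
      rcases le_max_iff.1 h4 with h5 | h5 <;> linarith
    nlinarith
  refine ⟨t, ht1, fun b hb => ?_⟩
  by_cases hb1 : ‖b‖ ≤ 1
  · have hbS : b ∈ S' := by simp [S', hb, hb1]
    rw [← Finset.mul_prod_erase _ _ hbS] at htn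
    have h1 : ∏ c ∈ S'.erase b, ‖t - c‖ ≤ 1 := by
      apply Finset.prod_le_one
      · intros; positivity
      · intro c hc
        have hc' := Finset.mem_of_mem_erase hc
        exact (hsub c hc').trans (max_le ht1 (Finset.mem_filter.1 hc').2)
    have h2 : 0 ≤ ∏ c ∈ S'.erase b, ‖t - c‖ := Finset.prod_nonneg fun _ _ => norm_nonneg _
    by_contra! hlt
    have h3 : ‖t - b‖ * ∏ c ∈ S'.erase b, ‖t - c‖ < 1 :=
      (mul_le_of_le_one_right (norm_nonneg _) h1).trans_lt hlt
    have h4 : ‖t‖ * (‖t - b‖ * ∏ c ∈ S'.erase b, ‖t - c‖) < 1 :=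
      (mul_le_of_le_one_left (by positivity) ht1).trans_lt h3
    exact h4.ne htn
  · push Not at hb1
    have := norm_sub_le_max' t (t - b)
    rw [sub_sub_cancel] at this
    rcases le_max_iff.1 this with h | h <;> linarith

/-- A generic point of a closed disk keeps the largest possible distance to finitely many given
points. -/
theorem exists_enorm_sub_eq_max (S : Finset K) (a : K) {c : K} (hc : c ≠ 0) :
    ∃ x : K, ∀ b ∈ S, ‖x - b‖ₑ = max ‖a - b‖ₑ ‖c‖ₑ := by
  classical
  obtain ⟨t, ht, hS⟩ := exists_norm_le_one_forall_one_le_norm_sub (S.image fun b => (b - a) / c)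
  have hcn : 0 < ‖c‖ := norm_pos_iff.2 hc
  refine ⟨a + t * c, fun b hb => ?_⟩
  have h1 : ‖c‖ ≤ ‖a + t * c - b‖ := by
    have h := hS _ (Finset.mem_image_of_mem _ hb)
    have : a + t * c - b = (t - (b - a) / c) * c := by field_simp; ring
    rw [this, norm_mul]
    exact le_mul_of_one_le_left hcn.le h
  have h2 : ‖t * c‖ ≤ ‖c‖ := by
    rw [norm_mul]; exact mul_le_of_le_one_left hcn.le ht
  have h3 : ‖a + t * c - b‖ = max ‖a - b‖ ‖c‖ := by
    apply le_antisymm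
    · have := IsUltrametricDist.norm_add_le_max (a - b) (t * c)
      rw [show a + t * c - b = a - b + t * c by ring]
      exact this.trans (max_le_max le_rfl h2)
    · apply max_le _ h1
      have := norm_sub_le_max' (a + t * c - b) (t * c)
      rw [show a + t * c - b - t * c = a - b by ring] at this
      exact this.trans (max_le le_rfl (h2.trans h1))
  simp only [← ofReal_norm]
  rw [h3, ENNReal.ofReal_max]

end Field

namespace BerkovichP1

/-! ### Points are determined by linear polynomials. -/

section Extensionality

variable {K : Type*} [NontriviallyNormedField K]

theorem map_multiset_prod (ζ : BerkovichP1 K) (s : Multiset (RatFunc K))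
    (h : ∀ f ∈ s, ζ f ≠ ∞) : ζ s.prod = (s.map ζ).prod ∧ ζ s.prod ≠ ∞ := by
  induction s using Multiset.induction_on with
  | empty => simp [map_one]
  | cons f s ih =>
    obtain ⟨h1, h2⟩ := ih fun g hg => h g (Multiset.mem_cons_of_mem hg)
    have hf := h f (Multiset.mem_cons_self f s)
    rw [Multiset.prod_cons, Multiset.map_cons, Multiset.prod_cons,
      ζ.map_mul' _ _ (fun h => h2 h.2) (fun h => hf h.1), ← h1]
    exact ⟨rfl, ENNReal.mul_ne_top hf h2⟩

theorem map_div (ζ : BerkovichP1 K) {f g : RatFunc K} (hg : g ≠ 0) (h : ζ f ≠ 0 ∨ ζ g ≠ 0)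
    (hft : ζ f ≠ ∞) : ζ (f / g) = ζ f / ζ g := by
  rw [div_eq_mul_inv, ζ.map_mul', ζ.map_inv hg, div_eq_mul_inv]
  · rw [ζ.map_inv hg, ENNReal.inv_eq_top]; tauto
  · rw [ζ.map_inv hg, ENNReal.inv_eq_zero]; tauto

/-- Used with g = 1 at points where y is finite and with g = y at ∞, where each (y - a)/y has the
finite value 1. -/
theorem algebraMap_div_pow_eq [IsAlgClosed K] (p : Polynomial K) (g : RatFunc K) :
    algebraMap (Polynomial K) (RatFunc K) p / g ^ p.roots.card =
      RatFunc.C p.leadingCoeff *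
        (p.roots.map fun a => (RatFunc.X - RatFunc.C a) / g).prod := by
  have h := congrArg (algebraMap (Polynomial K) (RatFunc K)) (IsAlgClosed.splits p).eq_prod_roots
  rw [map_mul, _root_.map_multiset_prod, Multiset.map_map, RatFunc.algebraMap_C] at h
  rw [h, Multiset.prod_map_div, Multiset.map_const', Multiset.prod_replicate, mul_div_assoc]
  congr 3
  refine Multiset.map_congr rfl fun a _ => ?_
  simp [RatFunc.algebraMap_X, RatFunc.algebraMap_C]

theorem map_algebraMap_div_pow [IsAlgClosed K] (ζ : BerkovichP1 K) (p : Polynomial K)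
    (g : RatFunc K) (h : ∀ a : K, ζ ((RatFunc.X - RatFunc.C a) / g) ≠ ∞) :
    ζ (algebraMap (Polynomial K) (RatFunc K) p / g ^ p.roots.card) =
      ‖p.leadingCoeff‖ₑ * (p.roots.map fun a => ζ ((RatFunc.X - RatFunc.C a) / g)).prod ∧
    ζ (algebraMap (Polynomial K) (RatFunc K) p / g ^ p.roots.card) ≠ ∞ := by
  obtain ⟨h1, h2⟩ := ζ.map_multiset_prod
    (p.roots.map fun a => (RatFunc.X - RatFunc.C a) / g) (by
      intro f hf
      obtain ⟨a, -, rfl⟩ := Multiset.mem_map.1 hf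
      exact h a)
  rw [algebraMap_div_pow_eq, ζ.map_mul' _ _ (fun h => h2 h.2) (by simp [ζ.map_C']), ζ.map_C',
    h1, Multiset.map_map]
  refine ⟨rfl, ENNReal.mul_ne_top enorm_ne_top ?_⟩
  rw [h1, Multiset.map_map] at h2
  exact h2

theorem map_div_X_eq_one (ζ : BerkovichP1 K) (h : ζ RatFunc.X = ∞) (a : K) :
    ζ ((RatFunc.X - RatFunc.C a) / RatFunc.X) = 1 := by
  have hX : (RatFunc.X : RatFunc K) ≠ 0 := RatFunc.X_ne_zero
  have h0 : ζ (-(RatFunc.C a * RatFunc.X⁻¹)) = 0 := by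
    rw [map_neg, ζ.map_mul'] <;> simp [ζ.map_inv hX, h, ζ.map_C']
  have := ζ.map_add_eq_right (f := -(RatFunc.C a * RatFunc.X⁻¹)) (g := 1)
    (by rw [h0, map_one]; exact one_pos)
  rw [map_one] at this
  rw [← this, sub_div, div_self hX, div_eq_mul_inv]
  ring_nf

/-- A point is determined by its values on the linear polynomials `y - b`. -/
theorem ext_of_X_sub_C [IsAlgClosed K] {ζ ξ : BerkovichP1 K}
    (h : ∀ b : K, ζ (RatFunc.X - RatFunc.C b) = ξ (RatFunc.X - RatFunc.C b)) : ζ = ξ := by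
  have hX : ζ RatFunc.X = ξ RatFunc.X := by simpa using h 0
  ext f
  rw [← RatFunc.num_div_denom f]
  set p := f.num
  set q := f.denom
  have hq : q ≠ 0 := RatFunc.denom_ne_zero f
  have hq' := RatFunc.algebraMap_ne_zero hq
  by_cases hXt : ξ RatFunc.X = ∞
  · have key : ∀ ζ : BerkovichP1 K, ζ RatFunc.X = ∞ → ∀ p : Polynomial K,
        ζ (algebraMap (Polynomial K) (RatFunc K) p / RatFunc.X ^ p.roots.card) =
          ‖p.leadingCoeff‖ₑ := by
      intro ζ hζ p
      rw [(ζ.map_algebraMap_div_pow p RatFunc.X (by simp [map_div_X_eq_one ζ hζ])).1]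
      simp [map_div_X_eq_one ζ hζ]
    by_cases hp : p = 0
    · simp [hp, map_zero]
    have hX0 : (RatFunc.X : RatFunc K) ≠ 0 := RatFunc.X_ne_zero
    -- The first factor has a finite nonzero value, so the indeterminacy at ∞ is confined to a power
    -- of y, whose value is 0, 1 or ∞ according to the degrees.
    have hdiv : algebraMap (Polynomial K) (RatFunc K) p / algebraMap (Polynomial K) (RatFunc K) q =
        (algebraMap (Polynomial K) (RatFunc K) p / RatFunc.X ^ p.roots.card) /
          (algebraMap (Polynomial K) (RatFunc K) q / RatFunc.X ^ q.roots.card) *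
          (RatFunc.X ^ p.roots.card * (RatFunc.X ^ q.roots.card)⁻¹) := by
      field_simp
    have hpow : ∀ ζ : BerkovichP1 K, ζ RatFunc.X = ∞ →
        ζ (RatFunc.X ^ p.roots.card * (RatFunc.X ^ q.roots.card)⁻¹) =
        if p.roots.card = q.roots.card then 1 else
          if p.roots.card < q.roots.card then 0 else ∞ := by
      intro ζ hζ
      split_ifs with h1 h2
      · rw [h1, mul_inv_cancel₀ (pow_ne_zero _ hX0), map_one]
      · obtain ⟨k, hk⟩ := Nat.exists_eq_add_of_lt h2
        rw [show (RatFunc.X : RatFunc K) ^ p.roots.card * (RatFunc.X ^ q.roots.card)⁻¹ =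
          (RatFunc.X ^ (k + 1))⁻¹ by rw [hk, add_assoc, pow_add]; field_simp,
          ζ.map_inv (pow_ne_zero _ hX0), map_pow, hζ]
        simp
      · obtain ⟨k, hk⟩ := Nat.exists_eq_add_of_lt (lt_of_le_of_ne (not_lt.1 h2) (Ne.symm h1))
        rw [show (RatFunc.X : RatFunc K) ^ p.roots.card * (RatFunc.X ^ q.roots.card)⁻¹ =
          RatFunc.X ^ (k + 1) by rw [hk, add_assoc, pow_add]; field_simp, map_pow, hζ]
        simp
    have hp' : ‖p.leadingCoeff‖ₑ ≠ 0 := by simpa using hp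
    have hq'' : ‖q.leadingCoeff‖ₑ ≠ 0 := by simpa using hq
    have hdp : ∀ ζ : BerkovichP1 K, ζ RatFunc.X = ∞ →
        ζ ((algebraMap (Polynomial K) (RatFunc K) p / RatFunc.X ^ p.roots.card) /
          (algebraMap (Polynomial K) (RatFunc K) q / RatFunc.X ^ q.roots.card)) =
        ‖p.leadingCoeff‖ₑ / ‖q.leadingCoeff‖ₑ := by
      intro ζ hζ
      rw [ζ.map_div (div_ne_zero hq' (pow_ne_zero _ hX0)), key ζ hζ, key ζ hζ] <;>
      simp [key ζ hζ, hp, hq]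
    have h0 : ‖p.leadingCoeff‖ₑ / ‖q.leadingCoeff‖ₑ ≠ 0 := ENNReal.div_ne_zero.2 ⟨hp', enorm_ne_top⟩
    have ht : ‖p.leadingCoeff‖ₑ / ‖q.leadingCoeff‖ₑ ≠ ∞ := ENNReal.div_ne_top enorm_ne_top hq''
    rw [hdiv, ζ.map_mul', ξ.map_mul', hdp ζ (hX.trans hXt), hdp ξ hXt, hpow ζ (hX.trans hXt),
      hpow ξ hXt]
    · rw [hdp ξ hXt]; tauto
    · rw [hdp ξ hXt]; tauto
    · rw [hdp ζ (hX.trans hXt)]; tauto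
    · rw [hdp ζ (hX.trans hXt)]; tauto
  · have hfin : ∀ ζ : BerkovichP1 K, ζ RatFunc.X ≠ ∞ → ∀ a : K,
        ζ ((RatFunc.X - RatFunc.C a) / 1) ≠ ∞ := by
      intro ζ hζ a
      rw [div_one]
      refine ne_top_of_le_ne_top ?_ (ζ.map_sub_le _ _)
      rw [ζ.map_C']
      exact (max_lt (lt_top_iff_ne_top.2 hζ) enorm_lt_top).ne
    have h1 := fun ζ hζ p => BerkovichP1.map_algebraMap_div_pow ζ p 1 (hfin ζ hζ)
    simp only [one_pow, div_one] at h1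
    -- A Bézout relation forbids 0/0, so the quotient rule applies.
    have hnz : ∀ ζ : BerkovichP1 K, ζ RatFunc.X ≠ ∞ →
        ζ (algebraMap (Polynomial K) (RatFunc K) p) ≠ 0 ∨
        ζ (algebraMap (Polynomial K) (RatFunc K) q) ≠ 0 := by
      intro ζ hζ
      by_contra! hc
      obtain ⟨u, v, huv⟩ := RatFunc.isCoprime_num_denom f
      have h2 := congrArg (fun p => ζ (algebraMap (Polynomial K) (RatFunc K) p)) huv
      simp only [_root_.map_add, map_mul, _root_.map_one, map_one] at h2
      have h3 := ζ.map_add_le' (algebraMap (Polynomial K) (RatFunc K) u *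
        algebraMap (Polynomial K) (RatFunc K) p) (algebraMap (Polynomial K) (RatFunc K) v *
        algebraMap (Polynomial K) (RatFunc K) q)
      rw [h2, ζ.map_mul' _ _ (by simp [hc.1]) (by simp [(h1 ζ hζ u).2]),
        ζ.map_mul' _ _ (by simp [hc.2]) (by simp [(h1 ζ hζ v).2]), hc.1, hc.2] at h3
      simp at h3
    have hXt' : ζ RatFunc.X ≠ ∞ := by rwa [hX]
    rw [ζ.map_div hq' (hnz ζ hXt') (h1 ζ hXt' p).2,
      ξ.map_div hq' (hnz ξ hXt) (h1 ξ hXt p).2,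
      (h1 ζ hXt' p).1, (h1 ζ hXt' q).1, (h1 ξ hXt p).1, (h1 ξ hXt q).1]
    simp only [h]

end Extensionality

/-! ### Compactness, density of classical points, local connectedness. -/

section Topology

open Filter Topology

variable {K : Type*} [NontriviallyNormedField K]

theorem isEmbedding_toFun : IsEmbedding (BerkovichP1.toFun : BerkovichP1 K → _) :=
  ⟨⟨rfl⟩, fun _ _ h => BerkovichP1.ext h⟩

theorem continuous_eval (f : RatFunc K) : Continuous fun ζ : BerkovichP1 K => ζ f :=
  (continuous_apply f).comp isEmbedding_toFun.continuous

instance : T2Space (BerkovichP1 K) := isEmbedding_toFun.t2Space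

/-- The axioms pass to limits. For the product rule, multiplication on [0, ∞] is continuous away
from 0 · ∞, and a product that is determinate in the limit is determinate eventually. -/
theorem isClosed_range_toFun : IsClosed (Set.range (BerkovichP1.toFun : BerkovichP1 K → _)) := by
  rw [isClosed_iff_ultrafilter]
  intro u l hl hr
  have ht : ∀ f, Tendsto (fun v : RatFunc K → ℝ≥0∞ => v f) l (𝓝 (u f)) := fun f =>
    ((continuous_apply f).tendsto u).mono_left hl
  have hnb : (l : Filter (RatFunc K → ℝ≥0∞)).NeBot := l.neBot
  refine ⟨⟨u, fun a => ?_, fun f g => ?_, fun f g h₁ h₂ => ?_⟩, rfl⟩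
  · refine tendsto_nhds_unique_of_eventuallyEq (ht _) tendsto_const_nhds ?_
    filter_upwards [hr]
    rintro _ ⟨ζ, rfl⟩
    exact ζ.map_C' a
  · refine le_of_tendsto_of_tendsto (ht _) ((ht f).max (ht g)) ?_
    filter_upwards [hr]
    rintro _ ⟨ζ, rfl⟩
    exact ζ.map_add_le' f g
  · refine tendsto_nhds_unique_of_eventuallyEq (ht _)
      (ENNReal.Tendsto.mul (ht f) (by tauto) (ht g) (by tauto)) ?_
    have key : ∀ f g, ¬(u f = 0 ∧ u g = ∞) →
        ∀ᶠ v : RatFunc K → ℝ≥0∞ in l, ¬(v f = 0 ∧ v g = ∞) := by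
      intro f g h
      rcases not_and_or.1 h with h | h
      · filter_upwards [(ht f).eventually_ne h] with v hv hv'
        exact hv hv'.1
      · filter_upwards [(ht g).eventually_ne h] with v hv hv'
        exact hv hv'.2
    filter_upwards [hr, key f g h₁, key g f (by tauto)]
    rintro _ ⟨ζ, rfl⟩ hv₁ hv₂
    exact ζ.map_mul' f g hv₁ (by tauto)

instance : CompactSpace (BerkovichP1 K) :=
  IsClosedEmbedding.compactSpace (f := BerkovichP1.toFun)
    ⟨isEmbedding_toFun, isClosed_range_toFun⟩

/-- The values of a point on the linear polynomials `y - b`. -/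
noncomputable def linearValues (ζ : BerkovichP1 K) (b : K) : ℝ≥0∞ := ζ (RatFunc.X - RatFunc.C b)

/-- A continuous injection from a compact space to a Hausdorff one. It lets points and paths be
constructed from formulas for their values on the y - b alone. -/
theorem isClosedEmbedding_linearValues [IsAlgClosed K] :
    IsClosedEmbedding (linearValues : BerkovichP1 K → K → ℝ≥0∞) :=
  Continuous.isClosedEmbedding (continuous_pi fun b => continuous_eval (RatFunc.X - RatFunc.C b))
    fun _ _ h => ext_of_X_sub_C fun b => congrFun h b

/-- Basic neighbourhoods are cut out by the values on finitely many linear polynomials. -/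
theorem exists_finset_nhds [IsAlgClosed K] {ζ : BerkovichP1 K} {V : Set (BerkovichP1 K)}
    (hV : V ∈ 𝓝 ζ) :
    ∃ (S : Finset K) (N : K → Set ℝ≥0∞), (0 : K) ∈ S ∧ (∀ b, N b ∈ 𝓝 (linearValues ζ b)) ∧
      ∀ ξ : BerkovichP1 K, (∀ b ∈ S, linearValues ξ b ∈ N b) → ξ ∈ V := by
  classical
  rw [isClosedEmbedding_linearValues.isInducing.nhds_eq_comap, mem_comap] at hV
  obtain ⟨t, ht, htV⟩ := hV
  rw [nhds_pi, Filter.mem_pi'] at ht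
  obtain ⟨S, N, hN, hS⟩ := ht
  refine ⟨insert 0 S, N, by simp, hN, fun ξ hξ => htV (hS fun b hb => hξ b ?_)⟩
  exact Finset.mem_insert_of_mem hb

variable [IsUltrametricDist K]

/-- Classical points are dense, also after the removal of finitely many of them. -/
theorem exists_classical_mem [IsAlgClosed K] {V : Set (BerkovichP1 K)} (hV : IsOpen V)
    (hne : V.Nonempty) (T : Finset K) : ∃ c : K, c ∉ T ∧ classical c ∈ V := by
  classical
  obtain ⟨ζ, hζ⟩ := hne
  obtain ⟨S, N, h0, hN, hNV⟩ := exists_finset_nhds (hV.mem_nhds hζ)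
  -- With a the nearest element of S, ζ agrees on S with the disk point around a of radius ζ(y - a).
  -- A nearby nonzero radius in the value group and a generic point of that disk then do.
  obtain ⟨a, haS, ha⟩ := S.exists_min_image (linearValues ζ) ⟨0, h0⟩
  have hM : ∀ᶠ ρ in 𝓝 (linearValues ζ a), ∀ b ∈ S, max ‖a - b‖ₑ ρ ∈ N b := by
    rw [Filter.eventually_all_finset]
    intro b hb
    have h1 : max ‖a - b‖ₑ (linearValues ζ a) = linearValues ζ b := by
      rw [← ζ.max_X_sub_C_eq (le_refl (linearValues ζ a))]
      exact max_eq_left (ha b hb)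
    have h2 : Continuous fun ρ : ℝ≥0∞ => max ‖a - b‖ₑ ρ := by fun_prop
    have := h2.tendsto (linearValues ζ a)
    rw [h1] at this
    exact this (hN b)
  have hD : Dense (Set.range (fun c : K => ‖c‖ₑ) \ {0}) :=
    Dense.sdiff_singleton (denseRange_enorm K) 0
  obtain ⟨U, hU, hUo, haU⟩ := mem_nhds_iff.1 hM
  obtain ⟨_, hcU, ⟨c, rfl⟩, hc⟩ := hD.inter_open_nonempty U hUo ⟨_, haU⟩
  have hc0 : c ≠ 0 := by simpa using hc
  obtain ⟨x, hx⟩ := exists_enorm_sub_eq_max (S ∪ T) a hc0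
  refine ⟨x, fun hxT => ?_, hNV _ fun b hb => ?_⟩
  · have := hx x (Finset.mem_union_right _ hxT)
    rw [sub_self, enorm_zero, eq_comm, max_eq_zero] at this
    exact hc this.2
  · rw [linearValues, classical_X_sub_C, hx b (Finset.mem_union_left _ hb)]
    exact hU hcU b hb

theorem denseRange_classical [IsAlgClosed K] :
    DenseRange (classical : K → BerkovichP1 K) := by
  rw [DenseRange, dense_iff_inter_open]
  intro V hV hne
  obtain ⟨c, -, hc⟩ := exists_classical_mem hV hne ∅
  exact ⟨_, hc, c, rfl⟩

/-- The point `ζ` can be moved up along its path to `∞`. -/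
theorem exists_linearValues_eq_max [IsAlgClosed K] (ζ : BerkovichP1 K) (ρ : ℝ≥0∞) :
    ∃ ξ : BerkovichP1 K, ∀ b, linearValues ξ b = max (linearValues ζ b) ρ := by
  have hcl := (isClosedEmbedding_linearValues (K := K)).isClosed_range
  have hcont := (isClosedEmbedding_linearValues (K := K)).continuous
  suffices h : ∀ ρ, (fun b => max (linearValues ζ b) ρ) ∈ Set.range (linearValues (K := K)) by
    obtain ⟨ξ, hξ⟩ := h ρ
    exact ⟨ξ, congrFun hξ⟩
  -- The condition is closed in ζ and in ρ, so density reduces it to a classical point a and ρ =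
  -- |c|. There generic points of the disk approximate the required values.
  refine denseRange_classical.induction_on
    (p := fun ζ => ∀ ρ, (fun b => max (linearValues ζ b) ρ) ∈ Set.range (linearValues (K := K)))
    ζ ?_ fun a ρ => ?_
  · simp only [Set.ofPred_forall]
    refine isClosed_iInter fun ρ => hcl.preimage ?_
    exact continuous_pi fun b => ((continuous_apply b).comp hcont).max continuous_const
  refine (denseRange_enorm K).induction_on
    (p := fun ρ => (fun b => max (linearValues (classical a) b) ρ) ∈
      Set.range (linearValues (K := K))) ρ ?_ fun c => ?_
  · refine hcl.preimage ?_
    exact continuous_pi fun b => continuous_const.max continuous_id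
  by_cases hc : c = 0
  · exact ⟨classical a, by simp [hc]⟩
  rw [← hcl.closure_eq, mem_closure_iff_nhds]
  intro t ht
  rw [nhds_pi, Filter.mem_pi'] at ht
  obtain ⟨S, N, hN, hS⟩ := ht
  obtain ⟨x, hx⟩ := exists_enorm_sub_eq_max S a hc
  refine ⟨_, hS fun b hb => ?_, classical x, rfl⟩
  have : linearValues (classical x) b = max (linearValues (classical a) b) ‖c‖ₑ := by
    rw [linearValues, linearValues, classical_X_sub_C, classical_X_sub_C, hx b hb]
  rw [this]
  exact mem_of_mem_nhds (hN b)

/-- Here A is for the level to which a point is raised and B for the value being raised. If s = t,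
one interval serves as both; if s < t, the intervals are separated and raising changes nothing. -/
theorem exists_nhds_max_mem {s t : ℝ≥0∞} (hst : s ≤ t) {N : Set ℝ≥0∞} (hN : N ∈ 𝓝 t) :
    ∃ A B : Set ℝ≥0∞, A ∈ 𝓝 s ∧ B ∈ 𝓝 t ∧ A.OrdConnected ∧ B.OrdConnected ∧ B ⊆ N ∧
      ∀ x ∈ A, ∀ y ∈ B, max y x ∈ B := by
  obtain ⟨B, hB, hBo, hBN⟩ : ∃ B, B ∈ 𝓝 t ∧ B.OrdConnected ∧ B ⊆ N := by
    obtain ⟨b, c, -, h1, h2⟩ := exists_Icc_mem_subset_of_mem_nhds hN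
    exact ⟨_, h1, Set.ordConnected_Icc, h2⟩
  rcases hst.eq_or_lt with rfl | hst
  · exact ⟨B, B, hB, hB, hBo, hBo, hBN, fun x hx y hy => by
      rcases max_choice y x with h | h <;> rw [h] <;> assumption⟩
  · obtain ⟨m, hsm, hmt⟩ := exists_between hst
    refine ⟨Set.Iio m, B ∩ Set.Ioi m, Iio_mem_nhds hsm, Filter.inter_mem hB (Ioi_mem_nhds hmt),
      Set.ordConnected_Iio, hBo.inter Set.ordConnected_Ioi,
      Set.inter_subset_left.trans hBN, fun x hx y hy => ?_⟩
    rw [max_eq_left (lt_trans hx hy.2).le]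
    exact hy

theorem max_mem_of_ordConnected {A : Set ℝ≥0∞} (hA : A.OrdConnected) {x y τ : ℝ≥0∞} (hx : x ∈ A)
    (hy : y ∈ A) (hτ : τ ≤ max x y) : max x τ ∈ A := by
  refine hA.out hx (y := max x y) ?_ ⟨le_max_left _ _, max_le (le_max_left _ _) hτ⟩
  rcases max_choice x y with h | h <;> rw [h] <;> assumption

/-- Basic neighbourhoods can be cut out by intervals around the values on S, compatible with raising
points. Two points of such a set, raised to the larger of their distances from the centre a, become
the same disk point, and order-convexity keeps both paths inside the set. -/
instance [IsAlgClosed K] : LocallyConnectedSpace (BerkovichP1 K) := by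
  rw [locallyConnectedSpace_iff_connected_basis]
  intro ζ
  refine Filter.hasBasis_self.2 fun V hV => ?_
  obtain ⟨S, N, h0, hN, hNV⟩ := exists_finset_nhds hV
  obtain ⟨a, haS, ha⟩ := S.exists_min_image (linearValues ζ) ⟨0, h0⟩
  choose! A B hA hB hAo hBo hBN hAB using fun b (hb : b ∈ S) => exists_nhds_max_mem (ha b hb) (hN b)
  let C : Set (BerkovichP1 K) :=
    {ξ | ∀ b ∈ S, linearValues ξ a ∈ A b ∧ linearValues ξ b ∈ B b}
  have hval : ∀ b, Continuous fun ξ : BerkovichP1 K => linearValues ξ b := fun b =>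
    continuous_eval (RatFunc.X - RatFunc.C b)
  refine ⟨C, ?_, ?_, fun ξ hξ => hNV ξ fun b hb => hBN b hb (hξ b hb).2⟩
  · change ∀ᶠ ξ in 𝓝 ζ, ∀ b ∈ S, _
    rw [Filter.eventually_all_finset]
    intro b hb
    exact Filter.inter_mem ((hval a).tendsto ζ (hA b hb)) ((hval b).tendsto ζ (hB b hb))
  · refine isPreconnected_of_forall_pair fun ξ hξ ξ' hξ' => ?_
    choose J hJ using fun ξ : BerkovichP1 K => exists_linearValues_eq_max ξ
    have hJc : ∀ ξ, Continuous (J ξ) := fun ξ => by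
      rw [isClosedEmbedding_linearValues.isInducing.continuous_iff]
      refine continuous_pi fun b => ?_
      simp only [Function.comp_apply, hJ]
      fun_prop
    set ρ := max (linearValues ξ a) (linearValues ξ' a) with hρ
    have hend : J ξ ρ = J ξ' ρ := ext_of_X_sub_C fun b => by
      have h1 := hJ ξ ρ b
      have h2 := hJ ξ' ρ b
      rw [linearValues] at h1 h2
      rw [h1, h2]
      exact (ξ.max_X_sub_C_eq (le_max_left _ _)).trans
        (ξ'.max_X_sub_C_eq (le_max_right _ _)).symm
    have hzero : ∀ ξ, J ξ 0 = ξ := fun ξ => ext_of_X_sub_C fun b => by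
      have := hJ ξ 0 b
      rwa [max_zero] at this
    have hsub : ∀ ξ ∈ C, ∀ ξ' ∈ C,
        J ξ '' Set.Icc 0 (max (linearValues ξ a) (linearValues ξ' a)) ⊆ C := by
      rintro ξ hξ ξ' hξ' _ ⟨τ, hτ, rfl⟩ b hb
      rw [hJ, hJ]
      have hA' := max_mem_of_ordConnected (hAo b hb) (hξ b hb).1 (hξ' b hb).1
        (le_refl (max (linearValues ξ a) (linearValues ξ' a)))
      refine ⟨max_mem_of_ordConnected (hAo b hb) (hξ b hb).1 (hξ' b hb).1 hτ.2, ?_⟩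
      refine (hBo b hb).out (hξ b hb).2 (hAB b hb _ ?_ _ (hξ b hb).2)
        ⟨le_max_left _ _, max_le_max le_rfl hτ.2⟩
      rwa [← max_assoc, max_self] at hA'
    refine ⟨J ξ '' Set.Icc 0 ρ ∪ J ξ' '' Set.Icc 0 ρ, Set.union_subset (hsub ξ hξ ξ' hξ') ?_,
      Or.inl ⟨0, ⟨le_rfl, zero_le⟩, hzero ξ⟩, Or.inr ⟨0, ⟨le_rfl, zero_le⟩, hzero ξ'⟩, ?_⟩
    · rw [hρ, max_comm]
      exact hsub ξ' hξ' ξ hξ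
    · exact IsPreconnected.union (J ξ ρ) ⟨ρ, ⟨zero_le, le_rfl⟩, rfl⟩
        ⟨ρ, ⟨zero_le, le_rfl⟩, hend.symm⟩
        (isPreconnected_Icc.image _ (hJc ξ).continuousOn)
        (isPreconnected_Icc.image _ (hJc ξ').continuousOn)

end Topology

end BerkovichP1

namespace BerkovichP1

/-! ### Weak approximation. -/

section Separation

variable {K : Type*} [NontriviallyNormedField K] [IsAlgClosed K]

/-- Inverting a function reverses the inequality between its two values, and a scalar with norm
strictly between them moves the threshold to 1. -/
theorem exists_lt_one_lt {ζ ξ : BerkovichP1 K} (h : ζ ≠ ξ) :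
    ∃ w : RatFunc K, ζ w < 1 ∧ 1 < ξ w := by
  have key : ∀ f, ζ f < ξ f → ∃ w : RatFunc K, ζ w < 1 ∧ 1 < ξ w := by
    intro f hf
    obtain ⟨c, h1, h2⟩ := exists_enorm_between (K := K) hf
    have hc : c ≠ 0 := by
      rintro rfl
      simp at h1
    have hc0 : ‖c‖ₑ ≠ 0 := by simpa using hc
    refine ⟨RatFunc.C c⁻¹ * f, ?_, ?_⟩
    · rw [ζ.map_C_mul (inv_ne_zero hc), enorm_inv hc, mul_comm, ← div_eq_mul_inv,
        ENNReal.div_lt_iff (Or.inl hc0) (Or.inl enorm_ne_top), one_mul]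
      exact h1
    · rw [ξ.map_C_mul (inv_ne_zero hc), enorm_inv hc, mul_comm, ← div_eq_mul_inv,
        ENNReal.lt_div_iff_mul_lt (Or.inl hc0) (Or.inl enorm_ne_top), one_mul]
      exact h2
  obtain ⟨f, hf⟩ : ∃ f, ζ f ≠ ξ f := by
    by_contra! hc
    exact h (BerkovichP1.ext (funext hc))
  rcases lt_or_gt_of_ne hf with hf | hf
  · exact key f hf
  · have hf0 : f ≠ 0 := by
      rintro rfl
      simp [map_zero] at hf
    apply key f⁻¹
    rw [ζ.map_inv hf0, ξ.map_inv hf0]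
    exact ENNReal.inv_lt_inv.2 hf

/-- Weak approximation: a point is separated from finitely many others by one function. -/
theorem exists_lt_one_forall_one_lt [IsUltrametricDist K] {ι : Type*} (s : Finset ι)
    (ζ : BerkovichP1 K) (ξ : ι → BerkovichP1 K) (h : ∀ i ∈ s, ζ ≠ ξ i) :
    ∃ w : RatFunc K, ζ w < 1 ∧ ∀ i ∈ s, 1 < ξ i w := by
  classical
  induction s using Finset.induction_on with
  | empty => exact ⟨0, by simp [map_zero], by simp⟩
  | insert j s hj ih =>
    obtain ⟨w, hw, hs⟩ := ih fun i hi => h i (Finset.mem_insert_of_mem hi)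
    obtain ⟨v, hv, hjv⟩ := exists_lt_one_lt (h j (Finset.mem_insert_self j s))
    -- If ξᵢ(v) > 1, two bad parameters differ by less than 1 in norm, so it is enough to stay at
    -- distance 1 from one of them. If ξᵢ(v) ≤ 1, then ξᵢ(w) > 1 and no t with |t| ≤ 1 is bad.
    let bad : ι → K → Prop := fun i t => ξ i (w + RatFunc.C t * v) ≤ 1
    obtain ⟨t, ht, hS⟩ := exists_norm_le_one_forall_one_le_norm_sub
      ((insert j s).image fun i => if h : ∃ t, bad i t then h.choose else 0)
    have ht0 : ∀ ζ : BerkovichP1 K, ζ v ≠ ∞ → ζ (RatFunc.C t * v) ≤ ζ v := by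
      intro ζ hζ
      by_cases h0 : t = 0
      · simp [h0, map_zero]
      rw [ζ.map_C_mul h0]
      refine mul_le_of_le_one_left' ?_
      rw [← ofReal_norm]
      exact ENNReal.ofReal_le_one.2 ht
    refine ⟨w + RatFunc.C t * v, ?_, fun i hi => ?_⟩
    · exact (ζ.map_add_le' _ _).trans_lt (max_lt hw ((ht0 ζ hv.ne_top).trans_lt hv))
    · by_contra! hb
      by_cases hiv : 1 < ξ i v
      · have hex : ∃ t, bad i t := ⟨t, hb⟩
        have h1 := hS _ (Finset.mem_image_of_mem _ hi)
        simp only [dif_pos hex] at h1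
        have h2 : ξ i (w + RatFunc.C hex.choose * v) ≤ 1 := hex.choose_spec
        set t' := hex.choose
        have h3 := (ξ i).map_sub_le (w + RatFunc.C t * v) (w + RatFunc.C t' * v)
        have hne : t - t' ≠ 0 := by
          intro h0
          simp [h0] at h1
          linarith
        rw [show w + RatFunc.C t * v - (w + RatFunc.C t' * v) = RatFunc.C (t - t') * v by
          rw [_root_.map_sub]; ring, (ξ i).map_C_mul hne] at h3
        have h4 : ξ i v ≤ ‖t - t'‖ₑ * ξ i v := by
          refine le_mul_of_one_le_left' ?_
          rw [← ofReal_norm]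
          exact ENNReal.one_le_ofReal.2 h1
        exact absurd (hiv.trans_le (h4.trans (h3.trans (max_le hb h2)))) (lt_irrefl _)
      · push Not at hiv
        have his : i ∈ s := by
          rcases Finset.mem_insert.1 hi with rfl | his
          · exact absurd hjv (not_lt.2 hiv)
          · exact his
        have h1 := (ht0 (ξ i) (ne_top_of_le_ne_top ENNReal.one_ne_top hiv)).trans hiv
        have h2 := (ξ i).map_sub_le (w + RatFunc.C t * v) (RatFunc.C t * v)
        rw [add_sub_cancel_right] at h2
        exact absurd ((hs i his).trans_le (h2.trans (max_le hb h1))) (lt_irrefl _)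

omit [IsAlgClosed K] in
-- Keeping numerator and denominator apart covers poles of f too, and matches the factors α - βT of
-- the resultant.
theorem norm_denom_le_norm_num_of_one_lt [IsUltrametricDist K] {a : K} {f : RatFunc K}
    (h : 1 < classical a f) :
    f.num.eval a ≠ 0 ∧ ‖f.denom.eval a‖ ≤ ‖f.num.eval a‖ := by
  rw [classical_apply] at h
  split_ifs at h with hd
  · refine ⟨fun h0 => ?_, by simp [hd]⟩
    obtain ⟨u, v, huv⟩ := RatFunc.isCoprime_num_denom f
    have := congrArg (Polynomial.eval a) huv
    simp [h0, hd] at this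
  · rw [← ofReal_norm, ENNReal.one_lt_ofReal, norm_div, one_lt_div (norm_pos_iff.2 hd)] at h
    exact ⟨norm_pos_iff.1 ((norm_nonneg _).trans_lt h), h.le⟩

end Separation

end BerkovichP1

/-! ### Elimination of y between two rational functions. -/

section Resultant

open Polynomial

theorem Polynomial.resultant_eq_zero_of_common_root {E : Type*} [Field E] {f g : E[X]} {n : ℕ}
    (hf : f ≠ 0) (hg : g.natDegree ≤ n) {y : E} (hfy : f.eval y = 0) (hgy : g.eval y = 0) :
    resultant f g f.natDegree n = 0 := by
  obtain ⟨h, rfl⟩ := dvd_iff_isRoot.2 hfy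
  have hh : h ≠ 0 := by rintro rfl; simp at hf
  rw [natDegree_mul (X_sub_C_ne_zero y) hh, resultant_mul_left _ _ _ _ hg, natDegree_X_sub_C,
    resultant_X_sub_C_left _ _ _ hg, hgy, zero_mul]

/-- The coefficients of `∏ (αᵢ - βᵢ T)` are dominated by the constant one if `|βᵢ| ≤ |αᵢ|`. -/
theorem norm_coeff_multiset_prod_le {K ι : Type*} [NontriviallyNormedField K] [IsUltrametricDist K]
    (s : Multiset ι) (α β : ι → K) (h : ∀ i ∈ s, ‖β i‖ ≤ ‖α i‖) (k : ℕ) :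
    ‖((s.map fun i => C (α i) - X * C (β i)).prod).coeff k‖ ≤ ‖(s.map α).prod‖ := by
  induction s using Multiset.induction_on generalizing k with
  | empty =>
    simp only [Multiset.map_zero, Multiset.prod_zero, coeff_one]
    split_ifs <;> simp
  | cons i s ih =>
    replace ih := ih fun j hj => h j (Multiset.mem_cons_of_mem hj)
    have hi := h i (Multiset.mem_cons_self i s)
    rw [Multiset.map_cons, Multiset.prod_cons, Multiset.map_cons, Multiset.prod_cons, sub_mul,
      coeff_sub, coeff_C_mul, mul_assoc, norm_mul]
    refine (norm_sub_le_max' _ _).trans (max_le ?_ ?_)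
    · rw [norm_mul]
      exact mul_le_mul_of_nonneg_left (ih k) (norm_nonneg _)
    · rcases k with _ | k
      · simp only [coeff_X_mul_zero, norm_zero]
        positivity
      · rw [coeff_X_mul, coeff_C_mul, norm_mul]
        exact mul_le_mul hi (ih k) (norm_nonneg _) (norm_nonneg _)

variable {K : Type*} [Field K]

/-- The polynomial `Res_Y(P(Y) - S Q(Y), A(Y) - T B(Y))` in `K[S][T]`. -/
noncomputable def graphResultant (P Q A B : K[X]) : K[X][X] :=
  resultant (P.map (C.comp C) - C (C X) * Q.map (C.comp C))
    (A.map (C.comp C) - C X * B.map (C.comp C))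
    (max P.natDegree Q.natDegree) (max A.natDegree B.natDegree)

theorem natDegree_sub_C_mul_le {R : Type*} [CommRing R] (P Q : R[X]) (s : R) :
    (P - C s * Q).natDegree ≤ max P.natDegree Q.natDegree :=
  (natDegree_sub_le _ _).trans (max_le_max le_rfl (natDegree_C_mul_le _ _))

theorem natDegree_sub_C_mul_eq {R : Type*} [CommRing R] (P Q : R[X]) (s : R)
    (h : P.coeff (max P.natDegree Q.natDegree) - s * Q.coeff (max P.natDegree Q.natDegree) ≠ 0) :
    (P - C s * Q).natDegree = max P.natDegree Q.natDegree :=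
  natDegree_eq_of_le_of_coeff_ne_zero (natDegree_sub_C_mul_le P Q s) (by simpa using h)

/-- The hypothesis on coefficients keeps the degree of P - sQ maximal, so that its roots are the
whole fibre of P/Q over s and the resultant is a product over that fibre. -/
theorem graphResultant_map_evalRingHom (P Q A B : K[X]) (s : K)
    (h : P.coeff (max P.natDegree Q.natDegree) - s * Q.coeff (max P.natDegree Q.natDegree) ≠ 0)
    (hs : (P - C s * Q).Splits) :
    (graphResultant P Q A B).map (evalRingHom s) =
      C ((P - C s * Q).leadingCoeff ^ max A.natDegree B.natDegree) *
        ((P - C s * Q).roots.map fun a => C (A.eval a) - X * C (B.eval a)).prod := by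
  have h1 := resultant_map_map (P.map (C.comp C) - C (C X) * Q.map (C.comp C))
    (A.map (C.comp C) - C X * B.map (C.comp C))
    (max P.natDegree Q.natDegree) (max A.natDegree B.natDegree) (mapRingHom (evalRingHom s))
  rw [← coe_mapRingHom, graphResultant, ← h1]
  have hC : (mapRingHom (evalRingHom s)).comp ((C : K[X] →+* K[X][X]).comp C) = C := by
    ext a : 1
    simp
  have h2 : (P.map (C.comp C) - C (C X) * Q.map (C.comp C)).map (mapRingHom (evalRingHom s)) =
      (P - C s * Q).map C := by
    simp only [Polynomial.map_sub, Polynomial.map_mul, Polynomial.map_map, hC, map_C]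
    simp
  have h3 : (A.map (C.comp C) - C X * B.map (C.comp C)).map (mapRingHom (evalRingHom s)) =
      A.map C - C X * B.map C := by
    simp only [Polynomial.map_sub, Polynomial.map_mul, Polynomial.map_map, hC, map_C]
    simp
  rw [h2, h3, ← natDegree_sub_C_mul_eq P Q s h, ← natDegree_map_eq_of_injective C_injective,
    resultant_eq_prod_eval _ _ _ _ (hs.map C), leadingCoeff_map_of_injective C_injective,
    hs.roots_map_of_injective C_injective]
  · rw [Multiset.map_map, C_pow]
    congr 2
    refine Multiset.map_congr rfl fun a _ => ?_
    simp
  · refine (natDegree_sub_C_mul_le _ _ _).trans ?_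
    rw [natDegree_map_eq_of_injective C_injective, natDegree_map_eq_of_injective C_injective]

/-- After specialisation, y is a common root of the two polynomials whose resultant is taken. With y
the variable of K(y), this is the algebraic relation between r and w. -/
theorem graphResultant_eval₂_eq_zero {E : Type*} [Field E] (f : K →+* E) (P Q A B : K[X])
    {r w y : E}
    (h : f (P.coeff (max P.natDegree Q.natDegree)) -
      r * f (Q.coeff (max P.natDegree Q.natDegree)) ≠ 0)
    (hr : P.eval₂ f y = r * Q.eval₂ f y) (hw : A.eval₂ f y = w * B.eval₂ f y) :
    (graphResultant P Q A B).eval₂ (eval₂RingHom f r) w = 0 := by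
  have h1 := resultant_map_map (P.map (C.comp C) - C (C X) * Q.map (C.comp C))
    (A.map (C.comp C) - C X * B.map (C.comp C))
    (max P.natDegree Q.natDegree) (max A.natDegree B.natDegree)
    (eval₂RingHom (eval₂RingHom f r) w)
  rw [← coe_eval₂RingHom, graphResultant, ← h1]
  have hC : (eval₂RingHom (eval₂RingHom f r) w).comp ((C : K[X] →+* K[X][X]).comp C) = f := by
    ext a
    simp
  have h2 : (P.map (C.comp C) - C (C X) * Q.map (C.comp C)).map
      (eval₂RingHom (eval₂RingHom f r) w) = P.map f - C r * Q.map f := by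
    simp only [Polynomial.map_sub, Polynomial.map_mul, Polynomial.map_map, hC, map_C]
    simp
  have h3 : (A.map (C.comp C) - C X * B.map (C.comp C)).map
      (eval₂RingHom (eval₂RingHom f r) w) = A.map f - C w * B.map f := by
    simp only [Polynomial.map_sub, Polynomial.map_mul, Polynomial.map_map, hC, map_C]
    simp
  rw [h2, h3]
  have hd := natDegree_sub_C_mul_eq (P.map f) (Q.map f) r (by simpa using h)
  rw [natDegree_map, natDegree_map] at hd
  rw [← hd]
  refine resultant_eq_zero_of_common_root ?_ ?_ (y := y) ?_ ?_
  · intro h0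
    have := congrArg (fun p => coeff p (max P.natDegree Q.natDegree)) h0
    simp at this
    exact h this
  · have := natDegree_sub_C_mul_le (A.map f) (B.map f) w
    rwa [natDegree_map, natDegree_map] at this
  · simp [eval_map, hr]
  · simp [eval_map, hw]

end Resultant

/-! ### Continuity and openness of skew products. -/

namespace DilatingSkewEndomorphism

open Filter Topology Polynomial BerkovichP1

variable {K : Type*} [NontriviallyNormedField K] (Ψ : DilatingSkewEndomorphism K)

theorem continuous_skewProduct : Continuous Ψ.skewProduct := by
  rw [isEmbedding_toFun.isInducing.continuous_iff]
  exact continuous_pi fun f =>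
    ENNReal.continuous_rpow_const.comp (continuous_eval (Ψ.toRingHom f))

theorem toRingHom_algebraMap (p : K[X]) :
    Ψ.toRingHom (algebraMap K[X] (RatFunc K) p) =
      (p.map (Ψ.base : K →+* K)).eval₂ RatFunc.C (Ψ.toRingHom RatFunc.X) := by
  have : Ψ.toRingHom.comp (algebraMap K[X] (RatFunc K)) =
      (eval₂RingHom RatFunc.C (Ψ.toRingHom RatFunc.X)).comp (mapRingHom (Ψ.base : K →+* K)) := by
    apply Polynomial.ringHom_ext
    · intro a
      simp [RatFunc.algebraMap_C, Ψ.map_C]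
    · simp [RatFunc.algebraMap_X]
  exact congrArg (fun g => g p) this

/-- Every constant is already the image of a constant, and Ψ is injective. -/
theorem toRingHom_X_ne_C (c : K) : Ψ.toRingHom RatFunc.X ≠ RatFunc.C c := by
  intro h
  rw [← Ψ.base.apply_symm_apply c, ← Ψ.map_C] at h
  have h2 := congrArg RatFunc.num (Ψ.toRingHom.injective h)
  rw [RatFunc.num_X, RatFunc.num_C] at h2
  exact Polynomial.X_ne_C _ h2

theorem enorm_base_rpow (a : K) : ‖Ψ.base a‖ₑ ^ Ψ.scale = ‖a‖ₑ := by
  have h := Ψ.scale_pos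
  rw [← ofReal_norm, ← ofReal_norm, Ψ.norm_base,
    ENNReal.ofReal_rpow_of_nonneg (by positivity) h.le, ← Real.rpow_mul (norm_nonneg _),
    one_div_mul_cancel h.ne', Real.rpow_one]

theorem norm_base_symm (a : K) : ‖Ψ.base.symm a‖ = ‖a‖ ^ Ψ.scale := by
  have h := Ψ.scale_pos
  have := Ψ.norm_base (Ψ.base.symm a)
  rw [RingEquiv.apply_symm_apply] at this
  rw [this, ← Real.rpow_mul (norm_nonneg _), one_div_mul_cancel h.ne', Real.rpow_one]

variable [IsUltrametricDist K] [IsAlgClosed K]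

theorem skewProduct_classical {a b : K}
    (ha : (Ψ.toRingHom RatFunc.X).denom.eval a ≠ 0)
    (hab : (Ψ.toRingHom RatFunc.X).num.eval a =
      Ψ.base b * (Ψ.toRingHom RatFunc.X).denom.eval a) :
    Ψ.skewProduct (classical a) = classical b := by
  refine ext_of_X_sub_C fun c => ?_
  change classical a (Ψ.toRingHom (RatFunc.X - RatFunc.C c)) ^ Ψ.scale = _
  set r := Ψ.toRingHom RatFunc.X with hr
  have h1 : Ψ.toRingHom (RatFunc.X - RatFunc.C c) =
      algebraMap K[X] (RatFunc K) (r.num - Polynomial.C (Ψ.base c) * r.denom) /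
        algebraMap K[X] (RatFunc K) r.denom := by
    rw [map_sub, Ψ.map_C, ← hr, map_sub, map_mul, sub_div, RatFunc.num_div_denom,
      RatFunc.algebraMap_C,
      mul_div_cancel_right₀ _ (RatFunc.algebraMap_ne_zero r.denom_ne_zero)]
  rw [h1, classical_div _ _ ha, classical_X_sub_C, ← Ψ.enorm_base_rpow (b - c), map_sub]
  congr 2
  simp only [eval_sub, eval_mul, eval_C, hab]
  field_simp

/-- A skew product is an open map. -/
theorem isOpenMap_skewProduct : IsOpenMap Ψ.skewProduct := by
  classical
  rw [isOpenMap_iff_nhds_le]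
  intro ζ V₀ hV₀
  set V := Ψ.skewProduct ⁻¹' V₀
  obtain ⟨V', hV', hV'V, hV'c⟩ := local_compact_nhds (show V ∈ 𝓝 ζ from hV₀)
  suffices h : Ψ.skewProduct '' V' ∈ 𝓝 (Ψ.skewProduct ζ) from
    mem_of_superset h (Set.image_subset_iff.2 hV'V)
  by_contra hnot
  have hcl : IsClosed (Ψ.skewProduct '' V') := (hV'c.image Ψ.continuous_skewProduct).isClosed
  set r := Ψ.toRingHom RatFunc.X with hr
  set d := max r.num.natDegree r.denom.natDegree with hd
  -- Only one s can lower the degree of P - sQ. If the denominator has no term of degree d, no s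
  -- does, and the excluded value is a harmless division by zero.
  have hdeg : ∀ s : K, s ≠ r.num.coeff d / r.denom.coeff d →
      r.num.coeff d - s * r.denom.coeff d ≠ 0 := by
    intro s hs h0
    by_cases hq : r.denom.coeff d = 0
    · have hp : r.num.coeff d = 0 := by simpa [hq] using h0
      rcases max_choice r.num.natDegree r.denom.natDegree with h | h
      · rw [hd, h, coeff_natDegree, leadingCoeff_eq_zero] at hp
        have hr0 : r = 0 := RatFunc.num_eq_zero_iff.1 hp
        exact Ψ.toRingHom_X_ne_C 0 (by rw [← hr, hr0, _root_.map_zero])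
      · rw [hd, h, coeff_natDegree, leadingCoeff_eq_zero] at hq
        exact r.denom_ne_zero hq
    · exact hs (by rw [eq_div_iff hq, sub_eq_zero.1 h0])
  set b₀ := Ψ.base.symm (r.num.coeff d / r.denom.coeff d) with hb₀
  -- Near `Ψ_* ζ` there are classical points that are not images of points of `V'`.
  have hG : (comap classical (𝓝 (Ψ.skewProduct ζ)) ⊓
      𝓟 {b : K | b ≠ b₀ ∧ classical b ∉ Ψ.skewProduct '' V'}).NeBot := by
    rw [inf_principal_neBot_iff]
    rintro U ⟨N, hN, hNU⟩
    obtain ⟨N', hN'N, hN'o, hN'⟩ := mem_nhds_iff.1 hN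
    obtain ⟨b, hb, hbN, hbV⟩ := exists_classical_mem (hN'o.inter hcl.isOpen_compl) (by
      by_contra hne
      rw [Set.not_nonempty_iff_eq_empty, ← Set.disjoint_iff_inter_eq_empty,
        Set.disjoint_compl_right_iff_subset] at hne
      exact hnot (mem_of_superset (hN'o.mem_nhds hN') hne)) {b₀}
    exact ⟨b, hNU (hN'N hbN), by simpa using hb, hbV⟩
  -- Along an ultrafilter all d preimages converge, by compactness.
  set l := Ultrafilter.of (comap classical (𝓝 (Ψ.skewProduct ζ)) ⊓
      𝓟 {b : K | b ≠ b₀ ∧ classical b ∉ Ψ.skewProduct '' V'}) with hl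
  have hle := Ultrafilter.of_le (comap classical (𝓝 (Ψ.skewProduct ζ)) ⊓
      𝓟 {b : K | b ≠ b₀ ∧ classical b ∉ Ψ.skewProduct '' V'})
  rw [← hl, le_inf_iff, le_principal_iff] at hle
  obtain ⟨hlt, hlb⟩ := hle
  have hlt : Tendsto classical l (𝓝 (Ψ.skewProduct ζ)) := tendsto_iff_comap.2 hlt
  -- The preimages of such a point, listed with multiplicity.
  have hroots : ∀ b : K, ∃ a : Fin d → K, b ≠ b₀ →
      (r.num - Polynomial.C (Ψ.base b) * r.denom).roots = Finset.univ.val.map a := by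
    intro b
    by_cases hb : b = b₀
    · exact ⟨0, fun h => absurd hb h⟩
    have hcard : (r.num - Polynomial.C (Ψ.base b) * r.denom).roots.toList.length = d := by
      rw [Multiset.length_toList, ← (IsAlgClosed.splits _).natDegree_eq_card_roots]
      refine natDegree_sub_C_mul_eq _ _ _ (hdeg _ fun h => hb ?_)
      rw [hb₀, ← h, RingEquiv.symm_apply_apply]
    refine ⟨fun i => (r.num - Polynomial.C (Ψ.base b) * r.denom).roots.toList.get
      (i.cast hcard.symm), fun _ => ?_⟩
    conv_lhs => rw [← Multiset.coe_toList (r.num - Polynomial.C (Ψ.base b) * r.denom).roots]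
    rw [Fin.univ_val_map, Multiset.coe_eq_coe]
    exact List.Perm.of_eq (List.ext_get (by simp [hcard]) (by simp))
  choose a ha using hroots
  have hroot : ∀ b, b ≠ b₀ → ∀ i, Ψ.skewProduct (classical (a b i)) = classical b := by
    intro b hb i
    have h1 : a b i ∈ (r.num - Polynomial.C (Ψ.base b) * r.denom).roots := by
      rw [ha b hb]
      exact Multiset.mem_map_of_mem _ (Finset.mem_univ i)
    have h2 := (mem_roots'.1 h1).2
    rw [IsRoot.def, eval_sub, eval_mul, eval_C, sub_eq_zero] at h2
    refine Ψ.skewProduct_classical (fun h0 => ?_) h2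
    obtain ⟨u, v, huv⟩ := RatFunc.isCoprime_num_denom r
    have := congrArg (Polynomial.eval (a b i)) huv
    rw [← hr] at h0
    simp [h0, h2] at this
  obtain ⟨ξ, hξ⟩ : ∃ ξ : Fin d → BerkovichP1 K,
      ∀ i, Tendsto (fun b => classical (a b i)) l (𝓝 (ξ i)) := by
    refine ⟨fun i => (l.map fun b => classical (a b i)).lim, fun i => ?_⟩
    exact (l.map fun b => classical (a b i)).le_nhds_lim
  -- If ξᵢ were ζ, some preimage of b would lie in V', contrary to the choice of b.
  have hne : ∀ i ∈ (Finset.univ : Finset (Fin d)), ζ ≠ ξ i := by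
    rintro i - rfl
    obtain ⟨b, hbV, hb, hbV'⟩ := ((hξ i).eventually hV' |>.and hlb).exists
    exact hbV' ⟨_, hbV, hroot b hb i⟩
  obtain ⟨w, hw, hw'⟩ := exists_lt_one_forall_one_lt Finset.univ ζ ξ hne
  set R := graphResultant r.num r.denom w.num w.denom with hR
  -- Eventually |w| > 1 on the whole fibre over b, so each factor α - βT of the specialised
  -- resultant has |β| ≤ |α| and α ≠ 0.
  have hev : ∀ᶠ b in l, (R.coeff 0).eval (Ψ.base b) ≠ 0 ∧
      ∀ k, ‖(R.coeff k).eval (Ψ.base b)‖ ≤ ‖(R.coeff 0).eval (Ψ.base b)‖ := by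
    have h1 : ∀ᶠ b in l, ∀ i, 1 < classical (a b i) w := by
      rw [eventually_all]
      intro i
      exact (((continuous_eval w).tendsto (ξ i)).comp (hξ i)).eventually
        (lt_mem_nhds (hw' i (Finset.mem_univ i)))
    filter_upwards [h1, hlb] with b hb1 hb2
    have hs := hdeg (Ψ.base b) fun h => hb2.1 (by rw [hb₀, ← h, RingEquiv.symm_apply_apply])
    have hmap := graphResultant_map_evalRingHom r.num r.denom w.num w.denom (Ψ.base b) hs
      (IsAlgClosed.splits _)
    have hcoeff : ∀ k, (R.coeff k).eval (Ψ.base b) =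
        (r.num - Polynomial.C (Ψ.base b) * r.denom).leadingCoeff ^
          max w.num.natDegree w.denom.natDegree *
        (((r.num - Polynomial.C (Ψ.base b) * r.denom).roots.map fun a =>
          Polynomial.C (w.num.eval a) - X * Polynomial.C (w.denom.eval a)).prod).coeff k := by
      intro k
      rw [← coe_evalRingHom, ← coeff_map, hR, hmap, coeff_C_mul]
    have hcoeff0 : (((r.num - Polynomial.C (Ψ.base b) * r.denom).roots.map fun a =>
          Polynomial.C (w.num.eval a) - X * Polynomial.C (w.denom.eval a)).prod).coeff 0 =
        ((r.num - Polynomial.C (Ψ.base b) * r.denom).roots.map fun a => w.num.eval a).prod := by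
      rw [coeff_zero_eq_eval_zero, ← coe_evalRingHom, _root_.map_multiset_prod, Multiset.map_map]
      simp
    have hdom : ∀ x ∈ (r.num - Polynomial.C (Ψ.base b) * r.denom).roots,
        w.num.eval x ≠ 0 ∧ ‖w.denom.eval x‖ ≤ ‖w.num.eval x‖ := by
      intro x hx
      rw [ha b hb2.1] at hx
      obtain ⟨i, -, rfl⟩ := Multiset.mem_map.1 hx
      exact norm_denom_le_norm_num_of_one_lt (hb1 i)
    have hlead : (r.num - Polynomial.C (Ψ.base b) * r.denom).leadingCoeff ≠ 0 := by
      rw [leadingCoeff, natDegree_sub_C_mul_eq _ _ _ hs]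
      simpa using hs
    rw [hcoeff 0, hcoeff0]
    refine ⟨mul_ne_zero (pow_ne_zero _ hlead) ?_, fun k => ?_⟩
    · rw [Ne, Multiset.prod_eq_zero_iff, Multiset.mem_map]
      rintro ⟨x, hx, h0⟩
      exact (hdom x hx).1 h0
    · rw [hcoeff k, norm_mul, norm_mul]
      exact mul_le_mul_of_nonneg_left
        (norm_coeff_multiset_prod_le _ _ _ (fun x hx => (hdom x hx).2) k) (norm_nonneg _)
  -- The coefficients of `R`, normalised and transported to the target, are bounded at `Ψ_* ζ`.
  let p : ℕ → K[X] := fun k => (R.coeff k).map (Ψ.base.symm : K →+* K)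
  have hp : ∀ k b, (p k).eval b = Ψ.base.symm ((R.coeff k).eval (Ψ.base b)) := by
    intro k b
    have := hom_eval₂ (R.coeff k) (RingHom.id K) (Ψ.base.symm : K →+* K) (Ψ.base b)
    simp only [eval₂_id, RingHom.comp_id, RingHom.coe_coe, RingEquiv.symm_apply_apply] at this
    rw [this, eval_map]
  have hp0 : p 0 ≠ 0 := by
    obtain ⟨b, hb, -⟩ := hev.exists
    intro h0
    have := hp 0 b
    rw [h0, eval_zero, eq_comm, map_eq_zero_iff _ Ψ.base.symm.injective] at this
    exact hb this
  let u : ℕ → RatFunc K := fun k => algebraMap K[X] (RatFunc K) (p k) /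
    algebraMap K[X] (RatFunc K) (p 0)
  have hu : ∀ k, ζ (Ψ.toRingHom (u k)) ≤ 1 := by
    intro k
    have h1 : Ψ.skewProduct ζ (u k) ≤ 1 := by
      refine le_of_tendsto (((continuous_eval (u k)).tendsto _).comp hlt) ?_
      filter_upwards [hev] with b hb
      have hb0 : (p 0).eval b ≠ 0 := by
        rw [hp, Ne, map_eq_zero_iff _ Ψ.base.symm.injective]
        exact hb.1
      rw [Function.comp_apply, classical_div _ _ hb0, ← ofReal_norm, ENNReal.ofReal_le_one,
        norm_div, div_le_one (norm_pos_iff.2 hb0), hp, hp, Ψ.norm_base_symm, Ψ.norm_base_symm]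
      exact Real.rpow_le_rpow (norm_nonneg _) (hb.2 k) Ψ.scale_pos.le
    change ζ (Ψ.toRingHom (u k)) ^ Ψ.scale ≤ 1 at h1
    rwa [← ENNReal.one_rpow Ψ.scale, ENNReal.rpow_le_rpow_iff Ψ.scale_pos] at h1
  have hΨp : ∀ k, Ψ.toRingHom (algebraMap K[X] (RatFunc K) (p k)) =
      (R.coeff k).eval₂ RatFunc.C r := by
    intro k
    rw [Ψ.toRingHom_algebraMap, ← hr, Polynomial.map_map]
    simp
  have hΨp0 : (R.coeff 0).eval₂ RatFunc.C r ≠ 0 := by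
    rw [← hΨp, Ne, map_eq_zero_iff _ Ψ.toRingHom.injective]
    exact RatFunc.algebraMap_ne_zero hp0
  have hX : ∀ f : RatFunc K, f.num.eval₂ RatFunc.C RatFunc.X =
      f * f.denom.eval₂ RatFunc.C RatFunc.X := by
    intro f
    have h1 : ∀ p : K[X], p.eval₂ RatFunc.C RatFunc.X = algebraMap K[X] (RatFunc K) p :=
      fun p => RatFunc.aeval_X_left_eq_algebraMap p
    rw [h1, h1, ← div_eq_iff (RatFunc.algebraMap_ne_zero f.denom_ne_zero), RatFunc.num_div_denom]
  have hzero : R.eval₂ (eval₂RingHom RatFunc.C r) w = 0 := by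
    refine graphResultant_eval₂_eq_zero RatFunc.C _ _ _ _ (fun h0 => ?_) (hX r) (hX w)
    rw [← hd, sub_eq_zero] at h0
    by_cases hq : r.denom.coeff d = 0
    · have h1 := hdeg (r.num.coeff d / r.denom.coeff d + 1) (by simp)
      rw [hq, _root_.map_zero, mul_zero, map_eq_zero_iff _ RatFunc.C_injective] at h0
      simp [h0, hq] at h1
    · refine Ψ.toRingHom_X_ne_C (r.num.coeff d / r.denom.coeff d) ?_
      rw [← hr, map_div₀, h0, mul_div_cancel_right₀]
      rwa [Ne, map_eq_zero_iff _ RatFunc.C_injective]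
  -- This is R(r, w) = 0 divided by its constant coefficient. Only positive powers of w remain and
  -- their coefficients have value at most 1, so ζ(w) < 1 would make the sum smaller than 1.
  have hsum : ∑ k ∈ Finset.range R.natDegree, Ψ.toRingHom (u (k + 1)) * w ^ (k + 1) = -1 := by
    rw [eval₂_eq_sum_range, Finset.sum_range_succ'] at hzero
    simp only [coe_eval₂RingHom, pow_zero, mul_one] at hzero
    have h1 : ∀ k, Ψ.toRingHom (u k) = (R.coeff k).eval₂ RatFunc.C r /
        (R.coeff 0).eval₂ RatFunc.C r := by
      intro k
      rw [map_div₀, hΨp, hΨp]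
    simp only [h1, div_mul_eq_mul_div]
    rw [← Finset.sum_div, div_eq_iff hΨp0, eq_neg_of_add_eq_zero_left hzero]
    ring
  have hlt1 : ζ (-1) ≤ ζ w := by
    rw [← hsum]
    refine ζ.map_sum_le _ _ fun k _ => ?_
    have hk : ζ (w ^ (k + 1)) ≤ ζ w := by
      rw [ζ.map_pow, pow_succ]
      exact mul_le_of_le_one_left' (pow_le_one₀ zero_le hw.le)
    have hkt : ζ (w ^ (k + 1)) ≠ ∞ := (hk.trans_lt hw).ne_top
    rw [ζ.map_mul' _ _ (fun h => hkt h.2)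
      (fun h => ENNReal.one_ne_top (top_le_iff.1 (h.1 ▸ hu (k + 1))))]
    exact (mul_le_of_le_one_left' (hu (k + 1))).trans hk
  rw [ζ.map_neg, ζ.map_one] at hlt1
  exact absurd hw (not_lt.2 hlt1)

end DilatingSkewEndomorphism

/-! ### Open maps and connected components. -/

section Components

variable {X : Type*} [TopologicalSpace X]

/-- The closure of a component of an open set adds only points outside that set. -/
theorem closure_connectedComponentIn_inter_subset {F : Set X} (x : X) :
    closure (connectedComponentIn F x) ∩ F ⊆ connectedComponentIn F x := by
  rintro y ⟨hy, hyF⟩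
  by_cases hx : x ∈ F
  · have h1 : IsPreconnected (insert y (connectedComponentIn F x)) :=
      isPreconnected_connectedComponentIn.subset_closure (Set.subset_insert _ _)
        (Set.insert_subset hy subset_closure)
    exact h1.subset_connectedComponentIn (Set.mem_insert_of_mem _ (mem_connectedComponentIn hx))
      (Set.insert_subset hyF (connectedComponentIn_subset F x)) (Set.mem_insert _ _)
  · rw [connectedComponentIn_eq_empty hx, closure_empty] at hy
    exact absurd hy (Set.notMem_empty y)

/-- An open map from a compact space sends a component `U` of the complement of `A` onto any
preconnected set `W` that contains its image, unless a point of `A` is mapped into `W`. -/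
theorem image_connectedComponentIn_eq_or_exists_mem {Y : Type*} [TopologicalSpace Y]
    [CompactSpace X] [LocallyConnectedSpace X] [T2Space Y] {f : X → Y} (hf : Continuous f)
    (hfo : IsOpenMap f) {A : Set X} (hA : IsClosed A) {x : X} (hx : x ∉ A) {W : Set Y}
    (hW : IsPreconnected W) (hUW : f '' connectedComponentIn Aᶜ x ⊆ W) :
    f '' connectedComponentIn Aᶜ x = W ∨ ∃ a ∈ A, f a ∈ W := by
  by_contra! hc
  set U := connectedComponentIn Aᶜ x
  have hxU : x ∈ U := mem_connectedComponentIn hx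
  have hU : IsOpen (f '' U) := hfo _ hA.isOpen_compl.connectedComponentIn
  have hV : IsClosed (f '' closure U) := (isClosed_closure.isCompact.image hf).isClosed
  refine hc.1 (hUW.antisymm fun w hw => ?_)
  by_contra hwU
  -- The closure of U adds only points of A, whose images miss W. Hence f(U) is both open and closed
  -- in W.
  have hsub : ∀ z ∈ W, z ∈ f '' closure U → z ∈ f '' U := by
    rintro _ hz ⟨y, hy, rfl⟩
    refine ⟨y, ?_, rfl⟩
    by_cases hyA : y ∈ A
    · exact absurd hz (hc.2 y hyA)
    · exact closure_connectedComponentIn_inter_subset x ⟨hy, hyA⟩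
  obtain ⟨z, -, hz1, hz2⟩ := hW (f '' U) (f '' closure U)ᶜ hU hV.isOpen_compl
    (fun z hz => by
      by_cases h : z ∈ f '' closure U
      · exact Or.inl (hsub z hz h)
      · exact Or.inr h)
    ⟨f x, hUW ⟨x, hxU, rfl⟩, x, hxU, rfl⟩ ⟨w, hw, fun h => hwU (hsub w hw h)⟩
  exact hz2 (Set.image_mono subset_closure hz1)

end Components

/-! ### Propagation of F-domains along the chain. -/

namespace BerkovichP1

variable {K : Type*} [NontriviallyNormedField K]

theorem IsGammaDomain.subset_compl {Γ U : Set (BerkovichP1 K)} (h : IsGammaDomain Γ U) :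
    U ⊆ Γᶜ := by
  obtain ⟨ζ, -, rfl⟩ := h
  exact connectedComponentIn_subset _ _

theorem IsGammaDomain.eq_connectedComponentIn {Γ U : Set (BerkovichP1 K)} (h : IsGammaDomain Γ U)
    {ζ : BerkovichP1 K} (hζ : ζ ∈ U) : U = connectedComponentIn Γᶜ ζ := by
  obtain ⟨ξ, -, rfl⟩ := h
  exact connectedComponentIn_eq hζ

end BerkovichP1

namespace PeriodicChain

open BerkovichP1

variable {K : Type*} [NontriviallyNormedField K] {N : ℕ} (φ : PeriodicChain K N)
  (Γ : ZMod N → Set (BerkovichP1 K))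

theorem iter_succ_eq_iter_comp (j : ZMod N) (n : ℕ) :
    φ.iter j (n + 1) = φ.iter (j + 1) n ∘ (φ j).skewProduct := by
  induction n with
  | zero => simp [iter]
  | succ n ih =>
    rw [iter, ih, iter, ← Function.comp_assoc]
    congr 4
    push_cast
    ring

/-- The condition that a point lies in the vertex set or in an F-domain. -/
def IsVertexOrF (j : ZMod N) (ζ : BerkovichP1 K) : Prop :=
  ζ ∈ Γ j ∨ ∃ U : Set (BerkovichP1 K), φ.IsFDomain Γ j U ∧ ζ ∈ U

variable {φ Γ}

theorem IsVertexOrF.notMem_of_isJDomain {j : ZMod N} {ζ : BerkovichP1 K} (h : φ.IsVertexOrF Γ j ζ)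
    {U : Set (BerkovichP1 K)} (hU : φ.IsJDomain Γ j U) : ζ ∉ U := by
  intro hζ
  rcases h with h | ⟨V, hV, hζV⟩
  · exact hU.1.subset_compl hζ h
  · refine hU.2 ?_
    rwa [hU.1.eq_connectedComponentIn hζ, ← hV.1.eq_connectedComponentIn hζV]

variable [IsUltrametricDist K] [IsAlgClosed K]

/-- If vertices are mapped to vertices or into F-domains, then so are the points of F-domains. -/
theorem IsFDomain.isVertexOrF_skewProduct {j : ZMod N} (hΓ : (Γ j).Finite)
    (h : ∀ ζ ∈ Γ j, φ.IsVertexOrF Γ (j + 1) ((φ j).skewProduct ζ))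
    {U : Set (BerkovichP1 K)} (hU : φ.IsFDomain Γ j U) {ζ : BerkovichP1 K} (hζ : ζ ∈ U) :
    φ.IsVertexOrF Γ (j + 1) ((φ j).skewProduct ζ) := by
  set f := (φ j).skewProduct with hf
  have hUc := hU.1.eq_connectedComponentIn hζ
  have hζΓ : ζ ∉ Γ j := hU.1.subset_compl hζ
  have hiter1 : φ.iter j 1 = f := by simp [iter, hf]
  have hfU : f '' U ⊆ (Γ (j + 1))ᶜ := by
    have := hU.2 1 le_rfl
    rw [hiter1, Nat.cast_one, ← Set.disjoint_iff_inter_eq_empty] at this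
    exact this.subset_compl_right
  have hfζ : f ζ ∈ f '' U := ⟨ζ, hζ, rfl⟩
  set W := connectedComponentIn (Γ (j + 1))ᶜ (f ζ) with hWdef
  have hWG : IsGammaDomain (Γ (j + 1)) W := ⟨f ζ, hfU hfζ, rfl⟩
  have hfζW : f ζ ∈ W := mem_connectedComponentIn (hfU hfζ)
  have hUW : f '' U ⊆ W := by
    refine IsPreconnected.subset_connectedComponentIn ?_ hfζ hfU
    rw [hUc]
    exact isPreconnected_connectedComponentIn.image _ (φ j).continuous_skewProduct.continuousOn
  right
  rcases image_connectedComponentIn_eq_or_exists_mem (φ j).continuous_skewProduct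
    (φ j).isOpenMap_skewProduct hΓ.isClosed hζΓ (W := W) isPreconnected_connectedComponentIn
    (by rwa [← hUc]) with hW | ⟨ξ, hξ, hξW⟩
  · rw [← hUc] at hW
    refine ⟨W, ⟨hWG, fun n _ => ?_⟩, hfζW⟩
    -- As W = f(U), the n-th image of W is the (n+1)-st image of U.
    have := hU.2 (n + 1) (Nat.succ_pos n)
    rw [iter_succ_eq_iter_comp, Set.image_comp, hW] at this
    rw [show j + 1 + (n : ZMod N) = j + ((n + 1 : ℕ) : ZMod N) by push_cast; ring]
    exact this
  · rcases h ξ hξ with hξΓ | ⟨V, hV, hξV⟩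
    · exact absurd hξΓ (hWG.subset_compl hξW)
    · refine ⟨W, ?_, hfζW⟩
      rwa [hWG.eq_connectedComponentIn hξW, ← hV.1.eq_connectedComponentIn hξV]

theorem isVertexOrF_iter (hΓ : ∀ j, (Γ j).Finite)
    (h : ∀ j, ∀ ζ ∈ Γ j, φ.IsVertexOrF Γ (j + 1) ((φ j).skewProduct ζ))
    {j : ZMod N} {ζ : BerkovichP1 K} (hζ : ζ ∈ Γ j) (n : ℕ) :
    φ.IsVertexOrF Γ (j + n) (φ.iter j n ζ) := by
  induction n with
  | zero => left; simpa [iter] using hζ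
  | succ n ih =>
    rw [Nat.cast_succ, ← add_assoc]
    rcases ih with ih | ⟨U, hU, hζU⟩
    · exact h _ _ ih
    · exact hU.isVertexOrF_skewProduct (hΓ _) (h _) hζU

end PeriodicChain

theorem mainTheorem8 {K : Type*} [NontriviallyNormedField K] [IsUltrametricDist K] [IsAlgClosed K]
    {N : ℕ} [NeZero N] (φ : PeriodicChain K N) (Γ : ZMod N → Set (BerkovichP1 K))
    (hΓ : ∀ j : ZMod N, BerkovichP1.IsVertexSet (Γ j)) :
    φ.IsAnalyticallyStable Γ ↔
      ∀ j : ZMod N, ∀ ζ ∈ Γ j,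
        (φ j).skewProduct ζ ∈ Γ (j + 1) ∨
          ∃ U : Set (BerkovichP1 K), φ.IsFDomain Γ (j + 1) U ∧ (φ j).skewProduct ζ ∈ U := by
  constructor
  · intro h j ζ hζ
    by_cases hmem : (φ j).skewProduct ζ ∈ Γ (j + 1)
    · exact Or.inl hmem
    have hU : (φ j).skewProduct ζ ∈
        connectedComponentIn (Γ (j + 1))ᶜ ((φ j).skewProduct ζ) := mem_connectedComponentIn hmem
    refine Or.inr ⟨_, ?_, hU⟩
    by_contra hF
    have hJ : φ.IsJDomain Γ (j + 1) (connectedComponentIn (Γ (j + 1))ᶜ ((φ j).skewProduct ζ)) :=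
      ⟨⟨_, hmem, rfl⟩, hF⟩
    refine h j ζ hζ ⟨hζ, 1, connectedComponentIn (Γ (j + 1))ᶜ ((φ j).skewProduct ζ), ?_, ?_⟩
    · rwa [Nat.cast_one]
    · simpa [PeriodicChain.iter] using hU
  · rintro h j ζ hζ ⟨-, n, U, hU, hn⟩
    exact (PeriodicChain.isVertexOrF_iter (fun j => (hΓ j).1) h hζ n).notMem_of_isJDomain hU hn
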